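/- All logarithms are to the base $2$. For a probability distribution $P$ on a finite set $\mathcal X$ put $H(P)=-\sum_x P(x)\log P(x)$ and $V(P)=\sum_x P(x)(-\log P(x)-H(P))^2$, and let $P^n$ be the $n$-fold i.i.d. distribution on $\mathcal X^n$. For distributions $R,R'$ on one finite set let $F(R,R')=\sum_y\sqrt{R(y)}\sqrt{R'(y)}$. Write $R\prec R'$ (for distributions on possibly different finite sets) if for every $l$ the sum of the $l$ largest values of $R$ is at most the sum of the $l$ largest values of $R'$. For distributions $P$ on $\mathcal X$, $Q$ on $\mathcal Y$ and a storage set $\mathcal B$ of cardinality $M$ (that is, of $\log M$ bits), put $$F^{\mathcal D}(P\to Q\,|\log M)=\sup\{F(W'\circ W(P),Q)\;:\;W:\mathcal X\to\mathcal B,\ W':\mathcal B\to\mathcal Y\},$$ where $f(P)$ denotes the image distribution of $P$ under a map $f$, and $$F^{\mathcal M}(P\to Q\,|\log M)=\sup\{F(P'',Q)\;:\;P\prec P'\prec P'',\ P'\text{ a distribution on }\mathcal B,\ P''\text{ a distribution on }\mathcal Y\}.$$ Let $\Phi$ be the standard normal distribution function and $N_{\mu,v}$ the density of the normal distribution with mean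 $\mu$ and variance $v$. For $v>0$ and $s,\mu\in\mathbb R$ the generalized Rayleigh-normal distribution function is $$Z_{v,s}(\mu)=1-\sup_{A\in\mathcal A_s}\left(\int_{\mathbb R}\sqrt{\tfrac{dA}{dx}(x)\,N_{\mu,v}(x)}\,dx\right)^2,$$ where $\mathcal A_s$ is the set of continuously differentiable monotone increasing functions $A:\mathbb R\to[0,1]$ with $A(s)=1$ and $\Phi\le A\le 1$. Theorem. Let $P$ and $Q$ be probability distributions on finite sets, neither of which is the uniform distribution on its support, and put $$C_{P,Q}=\frac{H(P)}{V(P)}\left(\frac{H(Q)}{V(Q)}\right)^{-1},\qquad D_{P,Q}=\frac{H(Q)}{\sqrt{V(P)}}.$$ Let $s_2,t_2\in\mathbb R$, and let $(M_n)$ and $(T_n)$ be sequences of non-negative integers such that $$S_n:=\log M_n=H(P)n+s_2\sqrt n+o(\sqrt n),\qquad T_n=\frac{H(P)}{H(Q)}n+t_2\sqrt n+o(\sqrt n).$$ Then $$\liminf_{n\to\infty}F^{\mathcal D}(P^n\to Q^{T_n}|S_n)=\liminf_{n\to\infty}F^{\mathcal M}(P^n\to Q^{T_n}|S_n)=\sqrt{1-Z_{C_{P,Q},\,s_2/\sqrt{V(P)}}(t_2D_{P,Q})}.$$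 -/

import Mathlib

open Filter Topology Asymptotics
open scoped BigOperators

noncomputable section

namespace RNC

variable {X Y : Type*} [Fintype X] [Fintype Y]

/-! Probability distributions on a finite set `X` are the functions `P : X → ℝ` that belong to
Mathlib's `stdSimplex ℝ X`. All logarithms are to the base `2`. -/

/-- Shannon entropy `H(P)`, in bits (with `0 log 0 = 0`). -/
def entropy (P : X → ℝ) : ℝ := ∑ x, P x * (-Real.logb 2 (P x))

/-- The varentropy `V(P) = ∑ P(x) (-log P(x) - H(P))²`. -/
def varentropy (P : X → ℝ) : ℝ := ∑ x, P x * (-Real.logb 2 (P x) - entropy P) ^ 2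

/-- `P` is a uniform distribution `U_l` on some `l`-element subset of `X` (its support). -/
def IsUniform (P : X → ℝ) : Prop := ∀ x y, P x ≠ 0 → P y ≠ 0 → P x = P y

/-- The `n`-fold i.i.d. distribution `P^n` on `X^n`. -/
def iid (P : X → ℝ) (n : ℕ) : (Fin n → X) → ℝ := fun x => ∏ i, P (x i)

open Classical in
/-- The distribution `W(P)` on `Y` obtained by applying the map `W : X → Y`:
`W(P)(y) = ∑_{x ∈ W⁻¹(y)} P(x)`. -/
def pushforward (W : X → Y) (P : X → ℝ) : Y → ℝ :=
  fun y => ∑ x with W x = y, P x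

/-- The fidelity (Bhattacharyya coefficient) of two distributions on the same finite set. -/
def fidelity (Q Q' : Y → ℝ) : ℝ := ∑ y, √(Q y) * √(Q' y)

/-- The list `P↓` of the values of `P` (with multiplicity) in decreasing order. -/
def decreasing (P : X → ℝ) : List ℝ := (Finset.univ.val.map P).sort (· ≥ ·)

/-- `P ≺ Q` (`P` is majorized by `Q`): for every `l`, the sum of the `l` largest values of `P` is
at most that of `Q`. The underlying sets may differ; a list with fewer than `l` entries is
summed completely. -/
def MajorizedBy (P : X → ℝ) (Q : Y → ℝ) : Prop :=
  ∀ l : ℕ, ((decreasing P).take l).sum ≤ ((decreasing Q).take l).sum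

/-- The maximal fidelity `F^D(P → Q | log₂ M)` of deterministic conversions of `P` into `Q` that
are routed through a storage with `M` elements (a storage of `N` bits has `M = 2 ^ N`). -/
def detFidelity (P : X → ℝ) (Q : Y → ℝ) (M : ℕ) : ℝ :=
  sSup {f | ∃ (W : X → Fin M) (W' : Fin M → Y), f = fidelity (pushforward (W' ∘ W) P) Q}

/-- The maximal fidelity `F^M(P → Q | log₂ M)` of majorization conversions of `P` into `Q` that
are routed through a storage with `M` elements (a storage of `N` bits has `M = 2 ^ N`). -/
def majFidelity (P : X → ℝ) (Q : Y → ℝ) (M : ℕ) : ℝ :=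
  sSup {f | ∃ P' ∈ stdSimplex ℝ (Fin M), ∃ P'' ∈ stdSimplex ℝ Y,
    MajorizedBy P P' ∧ MajorizedBy P' P'' ∧ f = fidelity P'' Q}

/-- The cumulative distribution function `Φ` of the standard normal distribution. -/
def stdNormalCDF (x : ℝ) : ℝ := ProbabilityTheory.cdf (ProbabilityTheory.gaussianReal 0 1) x

/-- The set `𝒜_s` of continuously differentiable, monotone increasing functions `A : ℝ → [0,1]`
with `A(s) = 1` and `Φ ≤ A ≤ 1`. -/
def admissibleCDF (s : ℝ) : Set (ℝ → ℝ) :=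
  {A | ContDiff ℝ 1 A ∧ Monotone A ∧ A s = 1 ∧ ∀ x, stdNormalCDF x ≤ A x ∧ A x ≤ 1}

/-- The continuous fidelity `∫ √(p(x) q(x)) dx`. -/
def contFidelity (p q : ℝ → ℝ) : ℝ := ∫ x, √(p x * q x)

/-- The generalized Rayleigh-normal distribution function `Z_{v,s}(μ)`, for a variance `v > 0`:
`1 - sup_{A ∈ 𝒜_s} F(dA/dx, N_{μ,v})²`. -/
def rayleighNormal (v s μ : ℝ) : ℝ :=
  1 - sSup ((fun A : ℝ → ℝ =>
    contFidelity (deriv A) (ProbabilityTheory.gaussianPDFReal μ v.toNNReal) ^ 2) ''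
      admissibleCDF s)

/-- `C_{P,Q} = (H(P)/V(P)) (H(Q)/V(Q))⁻¹`. -/
def coeffC (P : X → ℝ) (Q : Y → ℝ) : ℝ :=
  entropy P / varentropy P * (entropy Q / varentropy Q)⁻¹

/-- `D_{P,Q} = H(Q)/√V(P)`. -/
def coeffD (P : X → ℝ) (Q : Y → ℝ) : ℝ := entropy Q / √(varentropy P)

end RNC

end

open RNC

/-! Self-information is measured on the scale a_n + u b_n with a_n = H(P)n and b_n = √(V(P)n). By
the central limit theorem, the self-information of P^n has the limiting distribution function Φ(u),
that of Q^{T_n} has the limit G, the distribution function of the normal law with mean t₂D and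
variance C, and the storage bound log M_n sits at the coordinate s = s₂/√V(P). Since b_n → ∞,
shifting u by any δ > 0 changes weights and cardinalities by the unbounded factor 2^{δ b_n}. So only
one profile of a converted distribution matters: A(u), the mass of its 2^{a_n + u b_n} largest
values. Majorization becomes A ≥ Φ, storage becomes A(s) = 1, and the optimal fidelity becomes ∫
√(A' G').

A map only merges atoms, so F^D ≤ F^M (`detFidelity_le_majFidelity`). It remains to bound F^D below
and F^M above by the same number, which gives limits and not only lower limits.

Lower bound (`eventually_lt_detFidelity`): an admissible A is cut into cells of width δ below s, and
the A-mass of each cell is spread over a level set of Q^{T_n} in proportion to Q^{T_n}. The source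
atoms used are smaller than the target atoms by a factor 2^{-δ b_n}, so greedy filling
(`exists_filling`) is nearly exact; A ≥ Φ guarantees that enough small source atoms exist.

Upper bound (`eventually_majFidelity_le`): sorting and the Cauchy-Schwarz inequality on blocks bound
the fidelity by the masses of P'' and Q^{T_n} on a grid (`fidelity_le_sum_topSum`), and the grid
masses of P'' are interpolated by an admissible A (`exists_admissible_interpolation`).

The grid is fixed before n → ∞, so only finitely many limits are taken. The discretization error is
small because the square root of a Gaussian density is Lipschitz. -/

namespace RNC

open MeasureTheory ProbabilityTheory Set
open scoped NNReal

/-! ### Gaussian distribution functions and densities. -/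

section Gaussian

variable {μ : ℝ} {v : ℝ≥0}

theorem cdf_gaussianReal_eq_integral (hv : v ≠ 0) (x : ℝ) :
    cdf (gaussianReal μ v) x = ∫ t in Iic x, gaussianPDFReal μ v t := by
  rw [cdf_eq_real, measureReal_def, gaussianReal_apply_eq_integral _ hv,
    ENNReal.toReal_ofReal (integral_nonneg fun t => gaussianPDFReal_nonneg _ _ _)]

theorem cdf_gaussianReal_sub (hv : v ≠ 0) (x y : ℝ) :
    cdf (gaussianReal μ v) y - cdf (gaussianReal μ v) x =
      ∫ t in x..y, gaussianPDFReal μ v t := by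
  rw [cdf_gaussianReal_eq_integral hv, cdf_gaussianReal_eq_integral hv,
    intervalIntegral.integral_Iic_sub_Iic (integrable_gaussianPDFReal _ _).integrableOn
      (integrable_gaussianPDFReal _ _).integrableOn]

theorem continuous_gaussianPDFReal : Continuous (gaussianPDFReal μ v) := by
  unfold gaussianPDFReal
  fun_prop

theorem hasDerivAt_cdf_gaussianReal (hv : v ≠ 0) (x : ℝ) :
    HasDerivAt (cdf (gaussianReal μ v)) (gaussianPDFReal μ v x) x := by
  have h : (cdf (gaussianReal μ v) : ℝ → ℝ) = fun y =>
      cdf (gaussianReal μ v) 0 + ∫ t in (0 : ℝ)..y, gaussianPDFReal μ v t := by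
    funext y
    rw [← cdf_gaussianReal_sub hv]
    ring
  rw [h]
  exact (intervalIntegral.integral_hasDerivAt_right
    (continuous_gaussianPDFReal.intervalIntegrable _ _)
    (continuous_gaussianPDFReal.stronglyMeasurableAtFilter _ _)
    continuous_gaussianPDFReal.continuousAt).const_add _

theorem continuous_cdf_gaussianReal (hv : v ≠ 0) : Continuous (cdf (gaussianReal μ v)) :=
  continuous_iff_continuousAt.2 fun x => (hasDerivAt_cdf_gaussianReal hv x).continuousAt

theorem exists_cdf_gaussianReal_sub_eq (hv : v ≠ 0) {x y : ℝ} (hxy : x < y) :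
    ∃ ξ ∈ Ioo x y, cdf (gaussianReal μ v) y - cdf (gaussianReal μ v) x =
      (y - x) * gaussianPDFReal μ v ξ := by
  obtain ⟨ξ, hξ, h⟩ := exists_hasDerivAt_eq_slope (cdf (gaussianReal μ v)) (gaussianPDFReal μ v)
    hxy (continuous_cdf_gaussianReal hv).continuousOn
    fun t _ => hasDerivAt_cdf_gaussianReal hv t
  refine ⟨ξ, hξ, ?_⟩
  rw [h]
  field_simp [(sub_pos.2 hxy).ne']

theorem strictMono_cdf_gaussianReal (hv : v ≠ 0) : StrictMono (cdf (gaussianReal μ v)) := by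
  intro x y hxy
  obtain ⟨ξ, -, h⟩ := exists_cdf_gaussianReal_sub_eq (μ := μ) hv hxy
  have := mul_pos (sub_pos.2 hxy) (gaussianPDFReal_pos μ v ξ hv)
  linarith

/-- The square root of a Gaussian density is globally Lipschitz. -/
theorem exists_lipschitz_sqrt_gaussianPDFReal (hv : v ≠ 0) :
    ∃ L : ℝ, 0 ≤ L ∧ ∀ x y,
      |√(gaussianPDFReal μ v x) - √(gaussianPDFReal μ v y)| ≤ L * |x - y| := by
  have hv' : (0 : ℝ) < v := by positivity
  set c : ℝ := √((√(2 * Real.pi * v))⁻¹) with hc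
  have hc0 : 0 ≤ c := Real.sqrt_nonneg _
  have hform : ∀ x, √(gaussianPDFReal μ v x) = c * Real.exp (-(x - μ) ^ 2 / (4 * v)) := by
    intro x
    rw [gaussianPDFReal, Real.sqrt_mul (by positivity), ← Real.exp_half]
    congr 2
    field_simp
    norm_num
  have hd : ∀ x, HasDerivAt (fun x => √(gaussianPDFReal μ v x))
      (c * (Real.exp (-(x - μ) ^ 2 / (4 * v)) * (-(2 * (x - μ)) / (4 * v)))) x := by
    intro x
    rw [funext hform]
    have h1 : HasDerivAt (fun x : ℝ => -(x - μ) ^ 2 / (4 * v)) (-(2 * (x - μ)) / (4 * v)) x := by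
      have := ((((hasDerivAt_id x).sub_const μ).pow 2).neg).div_const (4 * (v : ℝ))
      simpa using this
    exact (h1.exp).const_mul c
  refine ⟨c * ((√v + 1) / (2 * v)), by positivity, fun x y => ?_⟩
  have hb : ∀ x ∈ (univ : Set ℝ),
      ‖c * (Real.exp (-(x - μ) ^ 2 / (4 * v)) * (-(2 * (x - μ)) / (4 * v)))‖ ≤
        c * ((√v + 1) / (2 * v)) := by
    intro x _
    rw [norm_mul, Real.norm_of_nonneg hc0]
    refine mul_le_mul_of_nonneg_left ?_ hc0
    set t := x - μ
    rw [norm_mul, Real.norm_of_nonneg (Real.exp_pos _).le, norm_div, norm_neg, norm_mul,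
      Real.norm_of_nonneg (by positivity : (0 : ℝ) ≤ 4 * v), Real.norm_eq_abs, Real.norm_eq_abs]
    -- With x = t²/(4v), the derivative is bounded through e^{-x}(1 + x) ≤ 1 and |t| ≤ √v (1 + x),
    -- the latter being a completed square.
    have h2 : Real.exp (-t ^ 2 / (4 * v)) * (1 + t ^ 2 / (4 * v)) ≤ 1 := by
      have h3 : 1 + t ^ 2 / (4 * v) ≤ Real.exp (t ^ 2 / (4 * v)) := by
        have := Real.add_one_le_exp (t ^ 2 / (4 * (v : ℝ)))
        linarith
      calc _ ≤ Real.exp (-t ^ 2 / (4 * v)) * Real.exp (t ^ 2 / (4 * v)) := by gcongr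
        _ = 1 := by rw [← Real.exp_add, neg_div, neg_add_cancel, Real.exp_zero]
    have h4 : |t| ≤ √v * (1 + t ^ 2 / (4 * v)) := by
      have hs : √(v : ℝ) * √(v : ℝ) = v := Real.mul_self_sqrt hv'.le
      have hs0 : 0 < √(v : ℝ) := Real.sqrt_pos.2 hv'
      have : √(v : ℝ) * (1 + t ^ 2 / (4 * v)) - |t| = √(v : ℝ) * (1 - |t| / (2 * √(v : ℝ))) ^ 2 := by
        rw [← sq_abs t]
        field_simp
        linear_combination (4 * (4 * (v : ℝ) + |t| ^ 2) - 16 * v) * hs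
      have : 0 ≤ √(v : ℝ) * (1 - |t| / (2 * √(v : ℝ))) ^ 2 := by positivity
      linarith
    have h5 : Real.exp (-t ^ 2 / (4 * v)) * |t| ≤ √v := by
      calc _ ≤ Real.exp (-t ^ 2 / (4 * v)) * (√v * (1 + t ^ 2 / (4 * v))) := by gcongr
        _ = √v * (Real.exp (-t ^ 2 / (4 * v)) * (1 + t ^ 2 / (4 * v))) := by ring
        _ ≤ √v * 1 := by gcongr
        _ = √v := mul_one _
    calc _ = (Real.exp (-t ^ 2 / (4 * v)) * |t|) / (2 * v) := by
          rw [abs_two]; field_simp; norm_num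
      _ ≤ (√v + 1) / (2 * v) := by gcongr; linarith
  have := convex_univ.norm_image_sub_le_of_norm_hasDerivWithin_le
    (fun x _ => (hd x).hasDerivWithinAt) hb (mem_univ y) (mem_univ x)
  simpa [Real.norm_eq_abs] using this

end Gaussian

/-! ### Smooth step functions. -/

section StepFunction

/-- A trapezoid of height `1` on the unit interval, with ramps of width `η`. -/
noncomputable def trapezoid (η x : ℝ) : ℝ := max 0 (min 1 (min (x / η) ((1 - x) / η)))

theorem continuous_trapezoid (η : ℝ) : Continuous (trapezoid η) := by
  unfold trapezoid
  fun_prop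

theorem trapezoid_nonneg (η x : ℝ) : 0 ≤ trapezoid η x := le_max_left _ _

theorem trapezoid_le_one (η x : ℝ) : trapezoid η x ≤ 1 :=
  max_le zero_le_one (min_le_left _ _)

theorem trapezoid_eq_zero_of_nonpos {η x : ℝ} (hη : 0 < η) (hx : x ≤ 0) : trapezoid η x = 0 :=
  max_eq_left ((min_le_right _ _).trans ((min_le_left _ _).trans
    (div_nonpos_of_nonpos_of_nonneg hx hη.le)))

theorem trapezoid_eq_zero_of_one_le {η x : ℝ} (hη : 0 < η) (hx : 1 ≤ x) : trapezoid η x = 0 :=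
  max_eq_left ((min_le_right _ _).trans ((min_le_right _ _).trans
    (div_nonpos_of_nonpos_of_nonneg (by linarith) hη.le)))

theorem trapezoid_eq_one {η x : ℝ} (hη : 0 < η) (h1 : η ≤ x) (h2 : x ≤ 1 - η) :
    trapezoid η x = 1 := by
  have h3 : 1 ≤ x / η := (one_le_div hη).2 h1
  have h4 : 1 ≤ (1 - x) / η := (one_le_div hη).2 (by linarith)
  rw [trapezoid, min_eq_left (le_min h3 h4), max_eq_right zero_le_one]

theorem le_integral_trapezoid {η : ℝ} (hη : 0 < η) (hη' : η < 1 / 2) :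
    1 - 2 * η ≤ ∫ x in (0 : ℝ)..1, trapezoid η x := by
  have hi : ∀ a b : ℝ, IntervalIntegrable (trapezoid η) volume a b :=
    fun a b => (continuous_trapezoid η).intervalIntegrable a b
  rw [← intervalIntegral.integral_add_adjacent_intervals (hi 0 η) (hi η 1),
    ← intervalIntegral.integral_add_adjacent_intervals (hi η (1 - η)) (hi (1 - η) 1)]
  have h1 : 0 ≤ ∫ x in (0 : ℝ)..η, trapezoid η x :=
    intervalIntegral.integral_nonneg hη.le fun x _ => trapezoid_nonneg _ _
  have h2 : 0 ≤ ∫ x in (1 - η)..1, trapezoid η x :=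
    intervalIntegral.integral_nonneg (by linarith) fun x _ => trapezoid_nonneg _ _
  have h3 : ∫ x in η..(1 - η), trapezoid η x = 1 - 2 * η := by
    rw [intervalIntegral.integral_congr (g := fun _ => (1 : ℝ))]
    · simp; ring
    · intro x hx
      rw [uIcc_of_le (by linarith)] at hx
      exact trapezoid_eq_one hη hx.1 hx.2
  linarith

/-- Continuously differentiable step functions on the unit interval whose derivative is, in the
sense of the fidelity, nearly uniform. -/
theorem exists_smooth_step {η : ℝ} (hη : 0 < η) (hη' : η < 1 / 2) :
    ∃ Ψ ψ : ℝ → ℝ, (∀ x, HasDerivAt Ψ (ψ x) x) ∧ Continuous ψ ∧ (∀ x, 0 ≤ ψ x) ∧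
      (∀ x ≤ 0, Ψ x = 0) ∧ (∀ x, 1 ≤ x → Ψ x = 1) ∧
      1 - 2 * η ≤ ∫ x in (0 : ℝ)..1, √(ψ x) := by
  set Z := ∫ x in (0 : ℝ)..1, trapezoid η x with hZ
  have hi : ∀ a b : ℝ, IntervalIntegrable (trapezoid η) volume a b :=
    fun a b => (continuous_trapezoid η).intervalIntegrable a b
  have hZl := le_integral_trapezoid hη hη'
  have hZ0 : 0 < Z := by linarith
  have hZ1 : Z ≤ 1 := by
    have : Z ≤ ∫ x in (0 : ℝ)..1, (1 : ℝ) :=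
      intervalIntegral.integral_mono_on zero_le_one (hi _ _) (by simp)
        fun x _ => trapezoid_le_one η x
    simpa using this
  refine ⟨fun x => (∫ t in (0 : ℝ)..x, trapezoid η t) / Z, fun x => trapezoid η x / Z, ?_, ?_, ?_,
    ?_, ?_, ?_⟩
  · intro x
    exact (intervalIntegral.integral_hasDerivAt_right (hi _ _)
      ((continuous_trapezoid η).stronglyMeasurableAtFilter _ _)
      (continuous_trapezoid η).continuousAt).div_const Z
  · exact (continuous_trapezoid η).div_const Z
  · exact fun x => div_nonneg (trapezoid_nonneg _ _) hZ0.le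
  · intro x hx
    have : ∫ t in (0 : ℝ)..x, trapezoid η t = ∫ t in (0 : ℝ)..x, (0 : ℝ) := by
      refine intervalIntegral.integral_congr fun t ht => ?_
      rw [uIcc_of_ge hx] at ht
      exact trapezoid_eq_zero_of_nonpos hη ht.2
    simp [this]
  · intro x hx
    have : ∫ t in (1 : ℝ)..x, trapezoid η t = ∫ t in (1 : ℝ)..x, (0 : ℝ) := by
      refine intervalIntegral.integral_congr fun t ht => ?_
      rw [uIcc_of_le hx] at ht
      exact trapezoid_eq_zero_of_one_le hη ht.1
    change (∫ t in (0 : ℝ)..x, trapezoid η t) / Z = 1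
    rw [← intervalIntegral.integral_add_adjacent_intervals (hi 0 1) (hi 1 x), this]
    simpa [← hZ] using div_self hZ0.ne'
  · refine hZl.trans (intervalIntegral.integral_mono_on zero_le_one (hi _ _)
      (((continuous_trapezoid η).div_const Z).sqrt.intervalIntegrable _ _) fun x _ => ?_)
    have h0 := trapezoid_nonneg η x
    -- The trapezoid h satisfies h² ≤ h ≤ h/Z, because 0 ≤ h ≤ 1 and Z ≤ 1.
    refine Real.le_sqrt_of_sq_le ?_
    rw [le_div_iff₀ hZ0]
    have := trapezoid_le_one η x
    nlinarith [mul_nonneg h0 h0, mul_nonneg h0 (sub_nonneg.2 this), mul_nonneg (mul_nonneg h0 h0) (sub_nonneg.2 hZ1)]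

end StepFunction

end RNC

namespace RNC

open Finset

/-! ### Sums of largest values, and majorization under maps. -/

section TopSum

variable {X Y : Type*} [Fintype X] [Fintype Y]

/-- The sum of the `l` largest values. -/
noncomputable def topSum (R : X → ℝ) (l : ℕ) : ℝ := ((decreasing R).take l).sum

/-- The sum of the first `l` entries of a vector. -/
noncomputable def headSum {N : ℕ} (f : Fin N → ℝ) (l : ℕ) : ℝ := ∑ i with i.val < l, f i

/-- Two sorted lists with the same multiset of entries coincide, so the list `decreasing R` can be
traded for an antitone vector. -/
theorem exists_equiv_antitone (R : X → ℝ) :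
    ∃ e : Fin (Fintype.card X) ≃ X, Antitone (R ∘ e) ∧
      ∀ l, topSum R l = headSum (R ∘ e) l := by
  set e₀ := (Fintype.equivFin X).symm
  set σ := Tuple.sort (OrderDual.toDual ∘ R ∘ e₀)
  set e := σ.trans e₀ with he
  have hm : Antitone (R ∘ e) := by
    intro i j hij
    exact (Tuple.monotone_sort (OrderDual.toDual ∘ R ∘ e₀)) hij
  refine ⟨e, hm, fun l => ?_⟩
  have hd : decreasing R = List.ofFn (R ∘ e) := by
    unfold decreasing
    refine List.Perm.eq_of_pairwise (le := (· ≥ ·)) (fun a b _ _ h1 h2 => le_antisymm h2 h1)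
      (Multiset.pairwise_sort _ _) ?_ ?_
    · rw [List.pairwise_ofFn]
      exact fun i j hij => hm hij.le
    · rw [← Multiset.coe_eq_coe, Multiset.sort_eq, ← Fin.univ_val_map, ← Multiset.map_map,
        ← map_univ_equiv e, Finset.map_val]
      rfl
  rw [topSum, hd, List.sum_take_ofFn, headSum]

variable {N : ℕ}

theorem headSum_mono {f : Fin N → ℝ} (hf : ∀ i, 0 ≤ f i) : Monotone (headSum f) := by
  intro l m hlm
  refine sum_le_sum_of_subset_of_nonneg (fun i hi => ?_) fun i _ _ => hf i
  simp only [mem_filter, mem_univ, true_and] at hi ⊢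
  omega

theorem headSum_of_le {f : Fin N → ℝ} {l : ℕ} (hl : N ≤ l) : headSum f l = ∑ i, f i := by
  rw [headSum, filter_true_of_mem]
  exact fun i _ => i.2.trans_le hl

theorem headSum_le_sum {f : Fin N → ℝ} (hf : ∀ i, 0 ≤ f i) (l : ℕ) : headSum f l ≤ ∑ i, f i :=
  (headSum_mono hf (le_max_left l N)).trans_eq (headSum_of_le (le_max_right l N))

theorem headSum_sub {f : Fin N → ℝ} {l m : ℕ} (hlm : l ≤ m) :
    headSum f m - headSum f l = ∑ i with l ≤ i.val ∧ i.val < m, f i := by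
  rw [headSum, headSum, sub_eq_iff_eq_add, ← sum_union]
  · refine sum_congr ?_ fun _ _ => rfl
    ext i
    simp only [mem_union, mem_filter, mem_univ, true_and]
    omega
  · rw [disjoint_filter]
    intro i _ h
    omega

/-- The leading entries of an antitone nonnegative vector have the largest sum. -/
theorem sum_le_headSum {f : Fin N → ℝ} (hf : ∀ i, 0 ≤ f i) (ha : Antitone f) (S : Finset (Fin N))
    {l : ℕ} (hS : #S ≤ l) : ∑ i ∈ S, f i ≤ headSum f l := by
  rcases le_or_gt N l with hl | hl
  · rw [headSum_of_le hl]
    exact sum_le_univ_sum_of_nonneg hf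
  · set I : Finset (Fin N) := {i | i.val < l} with hI
    have hIc : #I = l := by
      rw [hI, Fin.card_filter_val_lt, min_eq_right hl.le]
    -- Exchange argument: c separates the entries before position l from the others, and `S \ I` has
    -- at most as many elements as `I \ S`.
    set c := f ⟨l, hl⟩
    rw [headSum, ← hI, ← sum_sdiff_le_sum_sdiff]
    have h1 : ∑ i ∈ S \ I, f i ≤ #(S \ I) • c := by
      refine sum_le_card_nsmul _ _ _ fun i hi => ha ?_
      simp only [hI, Finset.mem_sdiff, mem_filter, mem_univ, true_and, not_lt] at hi
      exact hi.2
    have h2 : #(I \ S) • c ≤ ∑ i ∈ I \ S, f i := by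
      refine card_nsmul_le_sum _ _ _ fun i hi => ha ?_
      simp only [hI, Finset.mem_sdiff, mem_filter, mem_univ, true_and] at hi
      exact hi.1.le
    refine h1.trans (le_trans ?_ h2)
    exact nsmul_le_nsmul_left (hf _) (card_sdiff_le_card_sdiff_iff.2 (hS.trans_eq hIc.symm))

theorem topSum_mono {R : X → ℝ} (hR : ∀ x, 0 ≤ R x) : Monotone (topSum R) := by
  obtain ⟨e, -, h⟩ := exists_equiv_antitone R
  rw [funext h]
  exact headSum_mono fun i => hR _

theorem topSum_nonneg {R : X → ℝ} (hR : ∀ x, 0 ≤ R x) (l : ℕ) : 0 ≤ topSum R l := by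
  obtain ⟨e, -, h⟩ := exists_equiv_antitone R
  rw [h]
  exact sum_nonneg fun i _ => hR _

theorem topSum_le_sum {R : X → ℝ} (hR : ∀ x, 0 ≤ R x) (l : ℕ) : topSum R l ≤ ∑ x, R x := by
  obtain ⟨e, -, h⟩ := exists_equiv_antitone R
  rw [h]
  exact (headSum_le_sum (fun i => hR _) l).trans_eq (e.sum_comp R)

theorem topSum_of_card_le {R : X → ℝ} {l : ℕ} (hl : Fintype.card X ≤ l) :
    topSum R l = ∑ x, R x := by
  obtain ⟨e, -, h⟩ := exists_equiv_antitone R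
  rw [h, headSum_of_le hl]
  exact e.sum_comp R

/-- Together with `exists_topSum_eq`, this makes `topSum R l` the maximal mass of a set of at most l
elements, which often avoids sorting later. -/
theorem sum_le_topSum {R : X → ℝ} (hR : ∀ x, 0 ≤ R x) (S : Finset X) {l : ℕ} (hS : #S ≤ l) :
    ∑ x ∈ S, R x ≤ topSum R l := by
  obtain ⟨e, ha, h⟩ := exists_equiv_antitone R
  rw [h]
  calc ∑ x ∈ S, R x = ∑ i ∈ S.map e.symm.toEmbedding, (R ∘ e) i := by simp
    _ ≤ _ := sum_le_headSum (fun i => hR _) ha _ (by simpa using hS)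

theorem exists_topSum_eq (R : X → ℝ) (l : ℕ) : ∃ S : Finset X, #S ≤ l ∧ topSum R l = ∑ x ∈ S, R x := by
  obtain ⟨e, -, h⟩ := exists_equiv_antitone R
  refine ⟨(univ.filter fun i : Fin (Fintype.card X) => i.val < l).map e.toEmbedding, ?_, ?_⟩
  · rw [card_map, Fin.card_filter_val_lt]
    exact min_le_right _ _
  · simp [h, headSum]

theorem sum_pushforward (W : X → Y) (R : X → ℝ) : ∑ y, pushforward W R y = ∑ x, R x := by
  classical
  unfold pushforward
  convert sum_fiberwise univ W R

omit [Fintype Y] in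
theorem pushforward_nonneg (W : X → Y) {R : X → ℝ} (hR : ∀ x, 0 ≤ R x) (y : Y) :
    0 ≤ pushforward W R y := sum_nonneg fun x _ => hR x

theorem pushforward_mem_stdSimplex (W : X → Y) {R : X → ℝ} (hR : R ∈ stdSimplex ℝ X) :
    pushforward W R ∈ stdSimplex ℝ Y :=
  ⟨pushforward_nonneg W hR.1, (sum_pushforward W R).trans hR.2⟩

theorem pushforward_comp {Z : Type*} [Fintype Z] (W : X → Y) (W' : Y → Z) (R : X → ℝ) :
    pushforward (W' ∘ W) R = pushforward W' (pushforward W R) := by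
  classical
  funext z
  unfold pushforward
  rw [← sum_fiberwise_of_maps_to (s := univ.filter fun x => (W' ∘ W) x = z)
    (t := univ.filter fun y => W' y = z) (g := W) (by simp)]
  refine sum_congr (by congr) fun y hy => sum_congr ?_ fun _ _ => rfl
  simp only [mem_filter, mem_univ, true_and] at hy
  ext x
  simp only [mem_filter, mem_univ, true_and, Function.comp_apply]
  constructor
  · exact fun h => h.2
  · rintro rfl
    exact ⟨hy, rfl⟩

/-- If S carries the l largest values, then W(S) has at most l elements and its preimage contains S.
-/
theorem majorizedBy_pushforward (W : X → Y) {R : X → ℝ} (hR : ∀ x, 0 ≤ R x) :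
    MajorizedBy R (pushforward W R) := by
  classical
  intro l
  obtain ⟨S, hS, h⟩ := exists_topSum_eq R l
  change topSum R l ≤ topSum (pushforward W R) l
  rw [h]
  refine le_trans ?_ (sum_le_topSum (pushforward_nonneg W hR) (S.image W)
    (card_image_le.trans hS))
  rw [← sum_fiberwise_of_maps_to (s := S) (t := S.image W) (g := W)
    fun x hx => mem_image_of_mem W hx]
  refine sum_le_sum fun y _ => ?_
  unfold pushforward
  refine sum_le_sum_of_subset_of_nonneg (fun x hx => ?_) fun x _ _ => hR x
  simp only [mem_filter, mem_univ, true_and] at hx ⊢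
  exact hx.2

end TopSum

/-! ### Bounds on the fidelity. -/

section Fidelity

variable {X Y : Type*} [Fintype X] [Fintype Y]

theorem fidelity_nonneg (R S : Y → ℝ) : 0 ≤ fidelity R S :=
  sum_nonneg fun _ _ => mul_nonneg (Real.sqrt_nonneg _) (Real.sqrt_nonneg _)

theorem fidelity_le_one {R S : Y → ℝ} (hR : R ∈ stdSimplex ℝ Y) (hS : S ∈ stdSimplex ℝ Y) :
    fidelity R S ≤ 1 := by
  refine (Real.sum_sqrt_mul_sqrt_le univ hR.1 hS.1).trans ?_
  rw [hR.2, hS.2]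
  simp

theorem bddAbove_majFidelity (P : X → ℝ) {Q : Y → ℝ} (hQ : Q ∈ stdSimplex ℝ Y) (M : ℕ) :
    BddAbove {f | ∃ P' ∈ stdSimplex ℝ (Fin M), ∃ P'' ∈ stdSimplex ℝ Y,
      MajorizedBy P P' ∧ MajorizedBy P' P'' ∧ f = fidelity P'' Q} := by
  refine ⟨1, ?_⟩
  rintro f ⟨P', -, P'', hP'', -, -, rfl⟩
  exact fidelity_le_one hP'' hQ

theorem bddAbove_detFidelity {P : X → ℝ} {Q : Y → ℝ} (hP : P ∈ stdSimplex ℝ X)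
    (hQ : Q ∈ stdSimplex ℝ Y) (M : ℕ) :
    BddAbove {f | ∃ (W : X → Fin M) (W' : Fin M → Y), f = fidelity (pushforward (W' ∘ W) P) Q} := by
  refine ⟨1, ?_⟩
  rintro f ⟨W, W', rfl⟩
  exact fidelity_le_one (pushforward_mem_stdSimplex _ hP) hQ

theorem majFidelity_nonneg (P : X → ℝ) (Q : Y → ℝ) (M : ℕ) : 0 ≤ majFidelity P Q M := by
  refine Real.sSup_nonneg ?_
  rintro f ⟨P', -, P'', -, -, -, rfl⟩
  exact fidelity_nonneg _ _

/-- The witnesses are P' = W(P) and P'' = W'(W(P)), since every map produces a majorizing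
distribution. -/
theorem detFidelity_le_majFidelity {P : X → ℝ} {Q : Y → ℝ} (hP : P ∈ stdSimplex ℝ X)
    (hQ : Q ∈ stdSimplex ℝ Y) (M : ℕ) : detFidelity P Q M ≤ majFidelity P Q M := by
  refine Real.sSup_le ?_ (majFidelity_nonneg P Q M)
  rintro f ⟨W, W', rfl⟩
  refine le_csSup (bddAbove_majFidelity P hQ M) ⟨pushforward W P,
    pushforward_mem_stdSimplex W hP, pushforward W' (pushforward W P),
    pushforward_mem_stdSimplex W' (pushforward_mem_stdSimplex W hP),
    majorizedBy_pushforward W hP.1, majorizedBy_pushforward W' (pushforward_nonneg W hP.1), ?_⟩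
  rw [pushforward_comp]

/-- A map whose image has at most `M` elements factors through a storage of size `M`. -/
theorem fidelity_pushforward_le_detFidelity {P : X → ℝ} {Q : Y → ℝ} (hP : P ∈ stdSimplex ℝ X)
    (hQ : Q ∈ stdSimplex ℝ Y) {M : ℕ} (f : X → Y) (S : Finset Y) (hS : #S ≤ M)
    (hf : ∀ x, f x ∈ S) : fidelity (pushforward f P) Q ≤ detFidelity P Q M := by
  classical
  obtain ⟨ι⟩ : Nonempty (S ↪ Fin M) :=
    Function.Embedding.nonempty_of_card_le (by simpa using hS)
  rcases isEmpty_or_nonempty X with hX | ⟨⟨x₀⟩⟩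
  · exact absurd hP.2 (by simp)
  have : Nonempty S := ⟨⟨f x₀, hf x₀⟩⟩
  refine le_csSup (bddAbove_detFidelity hP hQ M)
    ⟨fun x => ι ⟨f x, hf x⟩, fun m => (Function.invFun ι m : S), ?_⟩
  congr 2
  funext x
  simp [Function.leftInverse_invFun ι.injective _]

/-- The fidelity does not decrease when both distributions are sorted. -/
theorem fidelity_le_sum_sorted {R S : Y → ℝ} {e e' : Fin (Fintype.card Y) ≃ Y}
    (he : Antitone (R ∘ e)) (he' : Antitone (S ∘ e')) :
    fidelity R S ≤ ∑ i, √((R ∘ e) i) * √((S ∘ e') i) := by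
  -- The rearrangement inequality applies to the square roots, which are sorted alike.
  have hm : Monovary (fun i => √((R ∘ e) i)) (fun i => √((S ∘ e') i)) :=
    Antitone.monovary (fun i j h => Real.sqrt_le_sqrt (he h))
      (fun i j h => Real.sqrt_le_sqrt (he' h))
  have := hm.sum_smul_comp_perm_le_sum_smul (σ := e.trans e'.symm)
  refine le_trans (le_of_eq ?_) this
  rw [fidelity, ← e.sum_comp]
  simp

theorem sum_sqrt_mul_sqrt_headSum_le {N : ℕ} {f g : Fin N → ℝ} (hf : ∀ i, 0 ≤ f i)
    (hg : ∀ i, 0 ≤ g i) {l m : ℕ} (hlm : l ≤ m) :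
    headSum (fun i => √(f i) * √(g i)) m ≤ headSum (fun i => √(f i) * √(g i)) l +
      √(headSum f m - headSum f l) * √(headSum g m - headSum g l) := by
  rw [← sub_le_iff_le_add', headSum_sub hlm, headSum_sub hlm, headSum_sub hlm]
  exact Real.sum_sqrt_mul_sqrt_le _ hf hg

/-- The Cauchy-Schwarz inequality is applied to each block between consecutive cut points, and once
to the initial block before l K. -/
theorem headSum_sqrt_mul_sqrt_le {N : ℕ} {f g : Fin N → ℝ} (hf : ∀ i, 0 ≤ f i)
    (hg : ∀ i, 0 ≤ g i) {l : ℕ → ℕ} (hl : Antitone l) (K : ℕ) :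
    headSum (fun i => √(f i) * √(g i)) (l 0) ≤
      (∑ j ∈ range K, √(headSum f (l j) - headSum f (l (j + 1))) *
        √(headSum g (l j) - headSum g (l (j + 1)))) +
      √(headSum f (l K)) * √(headSum g (l K)) := by
  have h : headSum (fun i => √(f i) * √(g i)) (l 0) ≤
      (∑ j ∈ range K, √(headSum f (l j) - headSum f (l (j + 1))) *
        √(headSum g (l j) - headSum g (l (j + 1)))) +
      headSum (fun i => √(f i) * √(g i)) (l K) := by
    induction K with
    | zero => simp
    | succ K ih =>
      rw [sum_range_succ]
      have := sum_sqrt_mul_sqrt_headSum_le hf hg (hl (Nat.le_succ K))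
      linarith
  refine h.trans (add_le_add_right ?_ _)
  exact Real.sum_sqrt_mul_sqrt_le _ hf hg

/-- Bound on the fidelity with a distribution that is concentrated on `l 0` elements, in terms of
the sums of the largest values. -/
theorem fidelity_le_sum_topSum {R S : Y → ℝ} (hR : R ∈ stdSimplex ℝ Y) (hS : S ∈ stdSimplex ℝ Y)
    {l : ℕ → ℕ} (hl : Antitone l) (h0 : topSum R (l 0) = 1) (K : ℕ) :
    fidelity R S ≤ (∑ j ∈ range K, √(topSum R (l j) - topSum R (l (j + 1))) *
        √(topSum S (l j) - topSum S (l (j + 1)))) + √(topSum S (l K)) := by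
  obtain ⟨e, he, hRe⟩ := exists_equiv_antitone R
  obtain ⟨e', he', hSe⟩ := exists_equiv_antitone S
  have hR0 : ∀ i, 0 ≤ (R ∘ e) i := fun i => hR.1 _
  have hS0 : ∀ i, 0 ≤ (S ∘ e') i := fun i => hS.1 _
  -- The l 0 largest values of R already sum to 1, so all further values vanish and the fidelity sum
  -- stops at l 0.
  have hz : ∀ i : Fin (Fintype.card Y), l 0 ≤ i.val → (R ∘ e) i = 0 := by
    intro i hi
    have h1 : headSum (R ∘ e) (l 0) + (R ∘ e) i ≤ 1 := by
      rw [← hR.2, ← e.sum_comp R, headSum, add_comm, ← sum_insert (by simp [hi])]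
      exact sum_le_univ_sum_of_nonneg hR0
    rw [← hRe, h0] at h1
    exact le_antisymm (by linarith) (hR0 i)
  have hfull : ∑ i, √((R ∘ e) i) * √((S ∘ e') i) =
      headSum (fun i => √((R ∘ e) i) * √((S ∘ e') i)) (l 0) := by
    rw [headSum]
    symm
    refine sum_subset (filter_subset _ _) fun i _ hi => ?_
    simp only [mem_filter, mem_univ, true_and, not_lt] at hi
    rw [hz i hi]
    simp
  refine (fidelity_le_sum_sorted he he').trans ?_
  rw [hfull]
  refine (headSum_sqrt_mul_sqrt_le hR0 hS0 hl K).trans ?_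
  simp only [← hRe, ← hSe]
  refine add_le_add_right ?_ _
  have : √(topSum R (l K)) ≤ 1 := Real.sqrt_le_one.2 ((topSum_le_sum hR.1 _).trans_eq hR.2)
  exact mul_le_of_le_one_left (Real.sqrt_nonneg _) this

end Fidelity

/-! ### Greedy filling of bins by small atoms. -/

section Filling

/-- Adding the atoms one at a time raises the sum by at most τ per step, so the last sum not
exceeding r misses it by at most τ. -/
theorem exists_subset_sum_mem_Icc {X : Type*} {p : X → ℝ} {τ r : ℝ} (hτ : 0 ≤ τ) (U : Finset X)
    (hU : ∀ x ∈ U, p x ≤ τ) (hr0 : 0 ≤ r) (hr : r ≤ ∑ x ∈ U, p x) :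
    ∃ V ⊆ U, r - τ ≤ ∑ x ∈ V, p x ∧ ∑ x ∈ V, p x ≤ r := by
  classical
  induction U using Finset.induction_on with
  | empty =>
    simp only [sum_empty] at hr
    exact ⟨∅, Subset.rfl, by simp; linarith, by simpa using hr0⟩
  | insert x U hx ih =>
    rcases le_or_gt r (∑ x ∈ U, p x) with h | h
    · obtain ⟨V, hV, h1, h2⟩ := ih (fun y hy => hU y (mem_insert_of_mem hy)) h
      exact ⟨V, hV.trans (subset_insert _ _), h1, h2⟩
    · refine ⟨U, subset_insert _ _, ?_, h.le⟩
      rw [sum_insert hx] at hr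
      have := hU x (mem_insert_self _ _)
      linarith

variable {X Y : Type*} [Fintype X]

open Classical in
/-- Greedy filling of the bins `y ∈ S` of sizes `r y` with atoms of `p`. A bin of level `j` admits
only atoms of weight at most `τ j`. -/
theorem exists_filling {p : X → ℝ} (hp : ∀ x, 0 ≤ p x) {r : Y → ℝ} (hr : ∀ y, 0 ≤ r y)
    {k : Y → ℕ} {τ : ℕ → ℝ} (hτ : ∀ j, 0 ≤ τ j) (S : Finset Y)
    (h : ∀ y ∈ S, ∑ y' ∈ S with k y' ≤ k y, r y' ≤ ∑ x with p x ≤ τ (k y), p x) :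
    ∃ f : X → Option Y, (∀ x y, f x = some y → y ∈ S) ∧
      ∀ y ∈ S, r y - τ (k y) ≤ ∑ x with f x = some y, p x ∧ ∑ x with f x = some y, p x ≤ r y := by
  induction S using Finset.induction_on_max_value k with
  | empty => exact ⟨fun _ => none, by simp, by simp⟩
  | insert y S hy hmax ih =>
    -- A bin of largest level is filled last. The earlier bins have consumed at most the sum of
    -- their sizes, so by h the unused atoms of weight at most τ (k y) still have mass at least r y;
    -- no monotonicity of τ is needed.
    obtain ⟨f, hf, hfS⟩ := ih fun z hz => by
      refine le_trans ?_ (h z (mem_insert_of_mem hz))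
      exact sum_le_sum_of_subset_of_nonneg (filter_subset_filter _ (subset_insert _ _))
        fun _ _ _ => hr _
    set U : Finset X := {x | p x ≤ τ (k y) ∧ f x = none} with hU
    have hused : ∑ x with f x ≠ none, p x ≤ ∑ z ∈ S, r z := by
      calc ∑ x with f x ≠ none, p x ≤ ∑ z ∈ S, ∑ x with f x = some z, p x := by
            rw [← sum_biUnion]
            · refine sum_le_sum_of_subset_of_nonneg (fun x hx => ?_) fun x _ _ => hp x
              simp only [mem_filter, mem_univ, true_and] at hx
              obtain ⟨z, hz⟩ := Option.ne_none_iff_exists'.1 hx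
              simp only [mem_biUnion, mem_filter, mem_univ, true_and]
              exact ⟨z, hf x z hz, hz⟩
            · intro z _ z' _ hzz
              rw [Function.onFun, disjoint_filter]
              rintro x _ h1 h2
              exact hzz (Option.some.inj (h1.symm.trans h2))
        _ ≤ _ := sum_le_sum fun z hz => (hfS z hz).2
    have htot : r y + ∑ z ∈ S, r z ≤ ∑ x with p x ≤ τ (k y), p x := by
      have := h y (mem_insert_self _ _)
      rwa [filter_true_of_mem, sum_insert hy] at this
      intro z hz
      rcases mem_insert.1 hz with rfl | hz
      · exact le_rfl
      · exact hmax z hz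
    have hUr : r y ≤ ∑ x ∈ U, p x := by
      have : ∑ x with p x ≤ τ (k y), p x ≤ ∑ x ∈ U, p x + ∑ x with f x ≠ none, p x := by
        rw [← sum_union]
        · refine sum_le_sum_of_subset_of_nonneg (fun x hx => ?_) fun x _ _ => hp x
          simp only [mem_filter, mem_univ, true_and] at hx
          simp only [hU, mem_union, mem_filter, mem_univ, true_and]
          tauto
        · rw [hU, disjoint_filter]
          tauto
      linarith
    obtain ⟨V, hVU, hV1, hV2⟩ := exists_subset_sum_mem_Icc (hτ (k y)) U
      (fun x hx => by simp only [hU, mem_filter, mem_univ, true_and] at hx; exact hx.1) (hr y) hUr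
    have hVn : ∀ x ∈ V, f x = none := fun x hx => by
      have := hVU hx
      simp only [hU, mem_filter, mem_univ, true_and] at this
      exact this.2
    refine ⟨fun x => if x ∈ V then some y else f x, fun x z hxz => ?_, fun z hz => ?_⟩
    · dsimp only at hxz
      split_ifs at hxz with hx
      · exact mem_insert.2 (Or.inl (Option.some.inj hxz).symm)
      · exact mem_insert_of_mem (hf x z hxz)
    · rcases mem_insert.1 hz with rfl | hz
      · have : (univ.filter fun x => (if x ∈ V then some z else f x) = some z) = V := by
          ext x
          simp only [mem_filter, mem_univ, true_and]
          split_ifs with hx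
          · simp [hx]
          · simp only [hx, iff_false]
            exact fun hh => hy (hf x z hh)
        rw [this]
        exact ⟨hV1, hV2⟩
      · have : (univ.filter fun x => (if x ∈ V then some y else f x) = some z) =
            univ.filter fun x => f x = some z := by
          ext x
          simp only [mem_filter, mem_univ, true_and]
          split_ifs with hx
          · rw [hVn x hx]
            simp only [Option.some.injEq, reduceCtorEq, iff_false]
            rintro rfl
            exact hy hz
          · rfl
        rw [this]
        exact hfS z hz

end Filling

end RNC

namespace RNC

open MeasureTheory ProbabilityTheory Set
open scoped NNReal

/-! ### The central limit theorem for self-information. -/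

section CentralLimit

variable {X : Type*} [Fintype X]

/-- The mass of the elements whose self-information (in bits) is at most `θ`. -/
noncomputable def lowMass (R : X → ℝ) (θ : ℝ) : ℝ := ∑ x with -Real.logb 2 (R x) ≤ θ, R x

theorem lowMass_mono {R : X → ℝ} (hR : ∀ x, 0 ≤ R x) : Monotone (lowMass R) := by
  intro θ θ' h
  refine Finset.sum_le_sum_of_subset_of_nonneg (fun x hx => ?_) fun x _ _ => hR x
  simp only [Finset.mem_filter, Finset.mem_univ, true_and] at hx ⊢
  exact hx.trans h

theorem iid_mem_stdSimplex {P : X → ℝ} (hP : P ∈ stdSimplex ℝ X) (n : ℕ) :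
    iid P n ∈ stdSimplex ℝ (Fin n → X) := by
  classical
  refine ⟨fun x => Finset.prod_nonneg fun i _ => hP.1 _, ?_⟩
  unfold iid
  rw [← Fintype.prod_sum (fun (_ : Fin n) x => P x)]
  simp [hP.2]

/-- A probability vector as a probability mass function. -/
noncomputable def toPMF (P : X → ℝ) (hP : P ∈ stdSimplex ℝ X) : PMF X :=
  PMF.ofFintype (fun x => ENNReal.ofReal (P x)) (by
    rw [← ENNReal.ofReal_sum_of_nonneg fun x _ => hP.1 x, hP.2, ENNReal.ofReal_one])

theorem toPMF_apply {P : X → ℝ} (hP : P ∈ stdSimplex ℝ X) (x : X) :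
    toPMF P hP x = ENNReal.ofReal (P x) := rfl

theorem lowMass_iid (P : X → ℝ) (n : ℕ) (θ : ℝ) :
    lowMass (iid P n) θ = ∑ x with ∑ i, -Real.logb 2 (P (x i)) ≤ θ, iid P n x := by
  rw [lowMass, Finset.sum_filter, Finset.sum_filter]
  refine Finset.sum_congr rfl fun x _ => ?_
  -- The logarithm of the product splits only when no factor is 0; the sequences excluded by this
  -- carry no mass.
  rcases eq_or_ne (iid P n x) 0 with h | h
  · simp [h]
  · have : ∀ i, P (x i) ≠ 0 := fun i => (Finset.prod_ne_zero_iff.1 h) i (Finset.mem_univ i)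
    rw [iid, Real.logb_prod _ _ fun i _ => this i, Finset.sum_neg_distrib]

/-- The central limit theorem as convergence of distribution functions. -/
theorem tendsto_measureReal_sum_le {Ω : Type*} [MeasurableSpace Ω] {κ : Measure Ω}
    [IsProbabilityMeasure κ] {ξ : ℕ → Ω → ℝ} {m v : ℝ} (hv : 0 < v) (hm : ∫ ω, ξ 0 ω ∂κ = m)
    (hvar : Var[ξ 0; κ] = v) (hL : MemLp (ξ 0) 2 κ) (hindep : iIndepFun ξ κ)
    (hident : ∀ i, IdentDistrib (ξ i) (ξ 0) κ κ) (hmeas : ∀ i, Measurable (ξ i)) (w : ℝ) :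
    Tendsto (fun n : ℕ => κ.real {ω | ∑ i ∈ Finset.range n, ξ i ω ≤ m * n + w * √n}) atTop
      (𝓝 (cdf (gaussianReal 0 v.toNNReal) w)) := by
  have hvn : v.toNNReal ≠ 0 := by simpa using hv
  have hY : HasLaw id (gaussianReal 0 Var[ξ 0; κ].toNNReal) (gaussianReal 0 v.toNNReal) := by
    rw [hvar]
    exact HasLaw.id
  have clt := (tendstoInDistribution_inv_sqrt_mul_sum_sub hY hL hindep hident).tendsto
  -- Portmanteau theorem: the frontier {w} of the half-line is null for a nondegenerate Gaussian.
  have h2 := ProbabilityMeasure.tendsto_measure_of_null_frontier_of_tendsto' clt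
    (E := Iic w) (by
      have := nullSingletonClass_gaussianReal (μ := 0) hvn
      simp)
  simp only [ProbabilityMeasure.coe_mk, Measure.map_id] at h2
  have h3 := (ENNReal.tendsto_toReal (measure_ne_top (gaussianReal 0 v.toNNReal) _)).comp h2
  rw [cdf_eq_real, measureReal_def]
  refine h3.congr' ?_
  filter_upwards [eventually_gt_atTop 0] with n hn
  have hs : 0 < √(n : ℝ) := Real.sqrt_pos.2 (by exact_mod_cast hn)
  rw [Function.comp_apply, Measure.map_apply (by fun_prop) measurableSet_Iic, measureReal_def]
  congr 2
  ext ω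
  simp only [mem_preimage, mem_Iic, mem_ofPred_eq]
  rw [hm, inv_mul_le_iff₀ hs, sub_le_iff_le_add', mul_comm (n : ℝ) m, mul_comm w]

/-- The central limit theorem needs one probability space for all n. The event depends on the first
n coordinates of the infinite product, whose joint law is P^n. -/
theorem measureReal_infinitePi_toPMF [MeasurableSpace X] [DiscreteMeasurableSpace X]
    {P : X → ℝ} (hP : P ∈ stdSimplex ℝ X) (n : ℕ) (θ : ℝ) :
    (Measure.infinitePi fun _ : ℕ => (toPMF P hP).toMeasure).real
      {ω | ∑ i ∈ Finset.range n, -Real.logb 2 (P (ω i)) ≤ θ} = lowMass (iid P n) θ := by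
  classical
  rw [lowMass_iid]
  set S : Finset (Fin n → X) := {x | ∑ i, -Real.logb 2 (P (x i)) ≤ θ} with hS
  have hpre : {ω : ℕ → X | ∑ i ∈ Finset.range n, -Real.logb 2 (P (ω i)) ≤ θ} =
      (fun (ω : ℕ → X) (i : Fin n) => ω i) ⁻¹' (S : Set (Fin n → X)) := by
    ext ω
    simp only [hS, mem_ofPred_eq, mem_preimage, Finset.mem_coe, Finset.mem_filter,
      Finset.mem_univ, true_and]
    rw [Finset.sum_range]
  rw [hpre, measureReal_def, ← Measure.map_apply (by fun_prop) S.measurableSet,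
    Measure.map_infinitePi_infinitePi_of_inj (P := fun _ : ℕ => (toPMF P hP).toMeasure)
      (f := fun i : Fin n => (i : ℕ)) Fin.val_injective, ← measureReal_def,
    ← sum_measureReal_singleton]
  refine Finset.sum_congr rfl fun x _ => ?_
  rw [measureReal_def, Measure.infinitePi_singleton_of_fintype, ENNReal.toReal_prod, iid]
  refine Finset.prod_congr rfl fun i _ => ?_
  rw [PMF.toMeasure_apply_singleton _ _ (measurableSet_singleton _), toPMF_apply,
    ENNReal.toReal_ofReal (hP.1 _)]

theorem tendsto_lowMass_iid_aux {P : X → ℝ} (hP : P ∈ stdSimplex ℝ X)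
    (hV : 0 < varentropy P) (w : ℝ) :
    Tendsto (fun n : ℕ => lowMass (iid P n) (entropy P * n + w * √n)) atTop
      (𝓝 (cdf (gaussianReal 0 (varentropy P).toNNReal) w)) := by
  let _ : MeasurableSpace X := ⊤
  have : DiscreteMeasurableSpace X := ⟨fun _ => trivial⟩
  set p := toPMF P hP with hp
  set κ : Measure (ℕ → X) := Measure.infinitePi fun _ => p.toMeasure with hκ
  set ξ : X → ℝ := fun x => -Real.logb 2 (P x) with hξ
  have hmξ : Measurable ξ := measurable_of_countable ξ
  have hint : ∀ f : X → ℝ, ∫ ω, f (ω 0) ∂κ = ∑ x, P x * f x := by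
    intro f
    have h1 : ∫ ω, f (ω 0) ∂κ = ∫ x, f x ∂p.toMeasure := by
      rw [← Measure.infinitePi_map_eval (fun _ : ℕ => p.toMeasure) 0,
        integral_map (measurable_pi_apply 0).aemeasurable
          (measurable_of_countable f).aestronglyMeasurable]
    rw [h1, PMF.integral_eq_sum]
    refine Finset.sum_congr rfl fun x _ => ?_
    rw [hp, toPMF_apply, ENNReal.toReal_ofReal (hP.1 x), smul_eq_mul]
  have hmean : ∫ ω, ξ (ω 0) ∂κ = entropy P := hint ξ
  have hm : ∀ i, Measurable fun ω : ℕ → X => ξ (ω i) :=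
    fun i => hmξ.comp (measurable_pi_apply i)
  have hvar : Var[fun ω => ξ (ω 0); κ] = varentropy P := by
    rw [variance_eq_integral (hm 0).aemeasurable, hmean]
    exact hint fun x => (ξ x - entropy P) ^ 2
  have hL2 : MemLp (fun ω : ℕ → X => ξ (ω 0)) 2 κ := by
    obtain ⟨C, hC⟩ := (Set.finite_range fun x => ‖ξ x‖).bddAbove
    exact MemLp.of_bound (hm 0).aestronglyMeasurable C
      (Eventually.of_forall fun ω => hC ⟨ω 0, rfl⟩)
  have hindep : iIndepFun (fun (i : ℕ) (ω : ℕ → X) => ξ (ω i)) κ :=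
    iIndepFun_infinitePi (X := fun _ => ξ) fun _ => hmξ
  have hident : ∀ i : ℕ, IdentDistrib (fun ω : ℕ → X => ξ (ω i)) (fun ω => ξ (ω 0)) κ κ := by
    intro i
    have : IdentDistrib (fun ω : ℕ → X => ω i) (fun ω => ω 0) κ κ :=
      ⟨(measurable_pi_apply i).aemeasurable, (measurable_pi_apply 0).aemeasurable, by
        rw [hκ, Measure.infinitePi_map_eval, Measure.infinitePi_map_eval]⟩
    exact this.comp hmξ
  refine (tendsto_measureReal_sum_le (ξ := fun (i : ℕ) (ω : ℕ → X) => ξ (ω i)) hV hmean hvar hL2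
    hindep hident hm w).congr fun n => ?_
  exact measureReal_infinitePi_toPMF hP n _

end CentralLimit

end RNC

namespace RNC

open MeasureTheory ProbabilityTheory Set
open scoped NNReal

/-! ### Normalization of source and target to a common scale. -/

section Scaling

theorem cdf_gaussianReal_affine {c : ℝ} (hc : 0 < c) (m d x : ℝ) {v v' : ℝ≥0}
    (hv : (v' : ℝ) = c ^ 2 * v) :
    cdf (gaussianReal (c * m + d) v') (c * x + d) = cdf (gaussianReal m v) x := by
  have hv' : v' = .mk (c ^ 2) (sq_nonneg c) * v := by
    ext
    simpa using hv
  rw [cdf_eq_real, cdf_eq_real, hv', ← gaussianReal_map_add_const, ← gaussianReal_map_const_mul,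
    Measure.map_map (by fun_prop) (by fun_prop),
    map_measureReal_apply (by fun_prop) measurableSet_Iic]
  congr 1
  ext y
  simp [hc]

variable {X Y : Type*} [Fintype X] [Fintype Y]

theorem neg_logb_nonneg_of_mem {P : X → ℝ} (hP : P ∈ stdSimplex ℝ X) (x : X) :
    0 ≤ -Real.logb 2 (P x) := by
  have h1 : P x ≤ 1 := hP.2 ▸ Finset.single_le_sum (fun y _ => hP.1 y) (Finset.mem_univ x)
  have := Real.logb_nonpos (b := 2) (by norm_num) (hP.1 x) h1
  linarith

theorem varentropy_pos {P : X → ℝ} (hP : P ∈ stdSimplex ℝ X) (hu : ¬ IsUniform P) :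
    0 < varentropy P := by
  have h0 : 0 ≤ varentropy P :=
    Finset.sum_nonneg fun x _ => mul_nonneg (hP.1 x) (sq_nonneg _)
  refine h0.lt_of_ne fun h => hu ?_
  have h1 := (Finset.sum_eq_zero_iff_of_nonneg
    fun x _ => mul_nonneg (hP.1 x) (sq_nonneg _)).1 h.symm
  have h2 : ∀ x, P x ≠ 0 → Real.logb 2 (P x) = -entropy P := by
    intro x hx
    have := (mul_eq_zero.1 (h1 x (Finset.mem_univ x))).resolve_left hx
    have := pow_eq_zero_iff (two_ne_zero) |>.1 this
    linarith
  intro x y hx hy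
  refine Real.logb_injOn_pos (b := 2) (by norm_num) ((hP.1 x).lt_of_ne' hx)
    ((hP.1 y).lt_of_ne' hy) ?_
  rw [h2 x hx, h2 y hy]

/-- If H(P) = 0, each term P(x)(-log P(x)) vanishes, hence so does V(P), which non-uniformity
excludes. -/
theorem entropy_pos {P : X → ℝ} (hP : P ∈ stdSimplex ℝ X) (hu : ¬ IsUniform P) :
    0 < entropy P := by
  have hn : ∀ x ∈ Finset.univ, 0 ≤ P x * (-Real.logb 2 (P x)) :=
    fun x _ => mul_nonneg (hP.1 x) (neg_logb_nonneg_of_mem hP x)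
  refine (Finset.sum_nonneg hn).lt_of_ne fun h => ?_
  have h1 := (Finset.sum_eq_zero_iff_of_nonneg hn).1 h.symm
  have h2 : varentropy P = 0 := by
    refine Finset.sum_eq_zero fun x hx => ?_
    change P x * (-Real.logb 2 (P x) - ∑ y, P y * (-Real.logb 2 (P y))) ^ 2 = 0
    rw [← h, sub_zero, sq, ← mul_assoc, h1 x hx, zero_mul]
  exact (varentropy_pos hP hu).ne' h2

/-- `lowMass` is monotone in the threshold, so a moving threshold is squeezed between fixed
normalized thresholds w' close to w; continuity of the Gaussian distribution function closes the
gap. -/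
theorem tendsto_lowMass_iid {P : X → ℝ} (hP : P ∈ stdSimplex ℝ X) (hV : 0 < varentropy P)
    {k : ℕ → ℕ} (hk : Tendsto k atTop atTop) {θ : ℕ → ℝ} {w : ℝ}
    (hθ : Tendsto (fun n => (θ n - entropy P * k n) / √(k n : ℝ)) atTop (𝓝 w)) :
    Tendsto (fun n => lowMass (iid P (k n)) (θ n)) atTop
      (𝓝 (cdf (gaussianReal 0 (varentropy P).toNNReal) w)) := by
  have hvn : (varentropy P).toNNReal ≠ 0 := by simpa using hV
  set F := cdf (gaussianReal 0 (varentropy P).toNNReal)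
  have hF : Continuous F := continuous_cdf_gaussianReal hvn
  have hpos : ∀ᶠ n in atTop, 0 < √(k n : ℝ) := by
    filter_upwards [hk.eventually_gt_atTop 0] with n hn
    exact Real.sqrt_pos.2 (by exact_mod_cast hn)
  have hmain : ∀ w', Tendsto (fun n => lowMass (iid P (k n)) (entropy P * k n + w' * √(k n : ℝ)))
      atTop (𝓝 (F w')) := fun w' => (tendsto_lowMass_iid_aux hP hV w').comp hk
  rw [tendsto_order]
  constructor
  · intro c hc
    obtain ⟨w', hw', hcw⟩ : ∃ w', c < F w' ∧ w' < w :=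
      (((hF.tendsto w).eventually (lt_mem_nhds hc)).filter_mono nhdsWithin_le_nhds
        |>.and (self_mem_nhdsWithin (s := Iio w))).exists
    filter_upwards [(hmain w').eventually (lt_mem_nhds hw'), hθ.eventually (lt_mem_nhds hcw), hpos]
      with n h1 h2 h3
    refine h1.trans_le (lowMass_mono (iid_mem_stdSimplex hP _).1 ?_)
    rw [lt_div_iff₀ h3] at h2
    linarith
  · intro c hc
    obtain ⟨w', hw', hcw⟩ : ∃ w', F w' < c ∧ w < w' :=
      (((hF.tendsto w).eventually (gt_mem_nhds hc)).filter_mono nhdsWithin_le_nhds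
        |>.and (self_mem_nhdsWithin (s := Ioi w))).exists
    filter_upwards [(hmain w').eventually (gt_mem_nhds hw'), hθ.eventually (gt_mem_nhds hcw), hpos]
      with n h1 h2 h3
    refine lt_of_le_of_lt (lowMass_mono (iid_mem_stdSimplex hP _).1 ?_) h1
    rw [div_lt_iff₀ h3] at h2
    linarith

theorem tendsto_lowMass_iid_source {P : X → ℝ} (hP : P ∈ stdSimplex ℝ X)
    (hV : 0 < varentropy P) (u : ℝ) :
    Tendsto (fun n : ℕ => lowMass (iid P n) (entropy P * n + u * √(varentropy P * n))) atTop
      (𝓝 (stdNormalCDF u)) := by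
  have h1 : stdNormalCDF u =
      cdf (gaussianReal 0 (varentropy P).toNNReal) (√(varentropy P) * u) := by
    have := cdf_gaussianReal_affine (Real.sqrt_pos.2 hV) 0 0 u (v := 1)
      (v' := (varentropy P).toNNReal) (by simp [Real.sq_sqrt hV.le, hV.le])
    simpa [stdNormalCDF] using this.symm
  rw [h1]
  refine tendsto_lowMass_iid hP hV tendsto_id (tendsto_const_nhds.congr' ?_)
  filter_upwards [eventually_gt_atTop 0] with n hn
  have hs : 0 < √(n : ℝ) := Real.sqrt_pos.2 (by exact_mod_cast hn)
  rw [Real.sqrt_mul hV.le]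
  simp only [id_eq]
  field_simp
  ring

/-- With ρ = H(P)/H(Q), the linear terms of the threshold and of H(Q)T_n cancel. A remainder (u√V(P)
- H(Q)t₂)√n is left, to be divided by √T_n ~ √(ρn). The affine map with slope √ρ/√V(P) then turns
N(0, V(Q)) into the normal law with mean t₂D and variance ρV(Q)/V(P) = C. -/
theorem tendsto_lowMass_iid_target {P : X → ℝ} {Q : Y → ℝ}
    (hQ : Q ∈ stdSimplex ℝ Y) (hHP : 0 < entropy P) (hHQ : 0 < entropy Q)
    (hVP : 0 < varentropy P) (hVQ : 0 < varentropy Q) {t₂ : ℝ} {T : ℕ → ℕ}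
    (hT : (fun n : ℕ => (T n : ℝ) - (entropy P / entropy Q * n + t₂ * √(n : ℝ)))
      =o[atTop] fun n : ℕ => √(n : ℝ)) (u : ℝ) :
    Tendsto (fun n : ℕ => lowMass (iid Q (T n)) (entropy P * n + u * √(varentropy P * n))) atTop
      (𝓝 (cdf (gaussianReal (t₂ * coeffD P Q) (coeffC P Q).toNNReal) u)) := by
  set ρ := entropy P / entropy Q with hρ
  have hρ0 : 0 < ρ := div_pos hHP hHQ
  set σ := √(varentropy P) with hσ
  have hσ0 : 0 < σ := Real.sqrt_pos.2 hVP
  set r : ℕ → ℝ := fun n => ((T n : ℝ) - (ρ * n + t₂ * √(n : ℝ))) / √(n : ℝ) with hr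
  have hr0 : Tendsto r atTop (𝓝 0) := hT.tendsto_div_nhds_zero
  have hsq : Tendsto (fun n : ℕ => √(n : ℝ)) atTop atTop :=
    Real.tendsto_sqrt_atTop.comp tendsto_natCast_atTop_atTop
  have hTeq : ∀ᶠ n : ℕ in atTop, (T n : ℝ) = ρ * n + (t₂ + r n) * √(n : ℝ) := by
    filter_upwards [eventually_gt_atTop 0] with n hn
    have hs : 0 < √(n : ℝ) := Real.sqrt_pos.2 (by exact_mod_cast hn)
    simp only [hr]
    field_simp
    ring
  have hratio : Tendsto (fun n : ℕ => (T n : ℝ) / n) atTop (𝓝 ρ) := by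
    have : Tendsto (fun n : ℕ => ρ + (t₂ + r n) * (√(n : ℝ))⁻¹) atTop (𝓝 (ρ + (t₂ + 0) * 0)) :=
      tendsto_const_nhds.add ((tendsto_const_nhds.add hr0).mul hsq.inv_tendsto_atTop)
    rw [mul_zero, add_zero] at this
    refine this.congr' ?_
    filter_upwards [hTeq, eventually_gt_atTop 0] with n h1 hn
    have hn' : (0 : ℝ) < n := by exact_mod_cast hn
    have hs : 0 < √(n : ℝ) := Real.sqrt_pos.2 hn'
    rw [h1]
    have : (n : ℝ) = √(n : ℝ) * √(n : ℝ) := (Real.mul_self_sqrt hn'.le).symm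
    rw [add_div, mul_div_cancel_right₀ _ hn'.ne', mul_div_assoc]
    congr 2
    rw [inv_eq_one_div, div_eq_div_iff hs.ne' hn'.ne', one_mul]
    exact this
  have hTtop : Tendsto T atTop atTop := by
    rw [← tendsto_natCast_atTop_iff (R := ℝ)]
    refine (hratio.pos_mul_atTop hρ0 tendsto_natCast_atTop_atTop).congr' ?_
    filter_upwards [eventually_gt_atTop 0] with n hn
    have hn' : (0 : ℝ) < n := by exact_mod_cast hn
    field_simp
  set w := (u * σ - entropy Q * t₂) / √ρ with hw
  have hsr : 0 < √ρ := Real.sqrt_pos.2 hρ0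
  have hcdf : cdf (gaussianReal (t₂ * coeffD P Q) (coeffC P Q).toNNReal) u =
      cdf (gaussianReal 0 (varentropy Q).toNNReal) w := by
    have hC : 0 ≤ coeffC P Q := by unfold coeffC; positivity
    have := cdf_gaussianReal_affine (div_pos hsr hσ0) 0 (t₂ * coeffD P Q) w
      (v := (varentropy Q).toNNReal) (v' := (coeffC P Q).toNNReal) (by
        rw [Real.coe_toNNReal _ hC, Real.coe_toNNReal _ hVQ.le, div_pow, Real.sq_sqrt hρ0.le, hσ,
          Real.sq_sqrt hVP.le, coeffC, hρ]
        field_simp)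
    rw [mul_zero, zero_add] at this
    rw [← this]
    congr 1
    rw [hw, coeffD, ← hσ]
    field_simp
    ring
  rw [hcdf]
  refine tendsto_lowMass_iid hQ hVQ hTtop ?_
  have hlim : Tendsto (fun n : ℕ => (u * σ - entropy Q * (t₂ + r n)) / √((T n : ℝ) / n)) atTop
      (𝓝 ((u * σ - entropy Q * (t₂ + 0)) / √ρ)) :=
    (tendsto_const_nhds.sub (tendsto_const_nhds.mul (tendsto_const_nhds.add hr0))).div
      hratio.sqrt hsr.ne'
  rw [add_zero, ← hw] at hlim
  refine hlim.congr' ?_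
  filter_upwards [hTeq, eventually_gt_atTop 0, hTtop.eventually_gt_atTop 0] with n h1 hn hTn
  have hn' : (0 : ℝ) < n := by exact_mod_cast hn
  have hs : 0 < √(n : ℝ) := Real.sqrt_pos.2 hn'
  have hTs : 0 < √(T n : ℝ) := Real.sqrt_pos.2 (by exact_mod_cast hTn)
  have hnum : entropy P * n + u * √(varentropy P * n) - entropy Q * T n =
      (u * σ - entropy Q * (t₂ + r n)) * √(n : ℝ) := by
    rw [h1, Real.sqrt_mul hVP.le, ← hσ]
    have : entropy P = entropy Q * ρ := by rw [hρ]; field_simp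
    rw [this]
    ring
  rw [hnum, Real.sqrt_div' _ hn'.le]
  field_simp

end Scaling

end RNC

namespace RNC

open Finset ProbabilityTheory

/-! ### Deterministic conversions built on a grid. -/

section Achievability

variable {X Y : Type*} [Fintype X] [Fintype Y]

/-- Each counted element has mass at least 2^(-θ). Elements of mass 0 must be left out: since `logb
2 0 = 0`, their self-information is 0 by default. -/
theorem card_filter_le_rpow {R : Y → ℝ} (hR : R ∈ stdSimplex ℝ Y) (θ : ℝ) :
    (#{y | 0 < R y ∧ -Real.logb 2 (R y) ≤ θ} : ℝ) ≤ 2 ^ θ := by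
  have h1 : #{y | 0 < R y ∧ -Real.logb 2 (R y) ≤ θ} • (2 : ℝ) ^ (-θ) ≤
      ∑ y with 0 < R y ∧ -Real.logb 2 (R y) ≤ θ, R y := by
    refine card_nsmul_le_sum _ _ _ fun y hy => ?_
    simp only [mem_filter, mem_univ, true_and] at hy
    rw [← Real.le_logb_iff_rpow_le (by norm_num) hy.1]
    linarith
  have h2 : ∑ y with 0 < R y ∧ -Real.logb 2 (R y) ≤ θ, R y ≤ 1 :=
    hR.2 ▸ sum_le_univ_sum_of_nonneg hR.1
  rw [nsmul_eq_mul, Real.rpow_neg (by norm_num), ← div_eq_mul_inv] at h1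
  have := h1.trans h2
  rwa [div_le_one (by positivity)] at this

theorem one_sub_lowMass_le {R : X → ℝ} (hR : R ∈ stdSimplex ℝ X) (θ : ℝ) :
    1 - lowMass R θ ≤ ∑ x with R x ≤ 2 ^ (-θ), R x := by
  rw [← hR.2, lowMass, ← sum_filter_add_sum_filter_not univ (fun x => -Real.logb 2 (R x) ≤ θ) R,
    add_sub_cancel_left]
  refine sum_le_sum_of_subset_of_nonneg (fun x hx => ?_) fun x _ _ => hR.1 x
  simp only [mem_filter, mem_univ, true_and, not_le] at hx ⊢
  rcases (hR.1 x).eq_or_lt with h | h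
  · rw [← h]
    positivity
  · rw [← Real.logb_le_iff_le_rpow (by norm_num) h]
    linarith

/-- Conversion that distributes the masses `w j` over level sets of `k`, in proportion to `q`. -/
theorem le_detFidelity_of_levels {p : X → ℝ} {q : Y → ℝ} (hp : p ∈ stdSimplex ℝ X)
    (hq : q ∈ stdSimplex ℝ Y) {M K : ℕ} {w τ : ℕ → ℝ} {η : ℝ} (hw : ∀ j, 0 ≤ w j)
    (hτ : ∀ j, 0 ≤ τ j) (S : Finset Y) (k : Y → ℕ) (hk : ∀ y ∈ S, k y < K)
    (hpos : ∀ j < K, 0 < ∑ y ∈ S with k y = j, q y)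
    (hfill : ∀ j < K, ∑ i ∈ range (j + 1), w i ≤ ∑ x with p x ≤ τ j, p x)
    (hsmall : ∀ y ∈ S, 0 < w (k y) → τ (k y) ≤ η * (w (k y) * q y)) (hη0 : 0 ≤ η) (hη : η ≤ 1)
    (hM : #S + 1 ≤ M) :
    √(1 - η) * ∑ j ∈ range K, √(w j) * √(∑ y ∈ S with k y = j, q y) ≤ detFidelity p q M := by
  classical
  set m : ℕ → ℝ := fun j => ∑ y ∈ S with k y = j, q y with hm
  have hm1 : ∀ j, m j ≤ 1 := fun j => hq.2 ▸ sum_le_univ_sum_of_nonneg hq.1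
  have hm0 : ∀ j, 0 ≤ m j := fun j => sum_nonneg fun y _ => hq.1 y
  -- Bin sizes are proportional to q within each level and add up to w j on level j.
  set r : Y → ℝ := fun y => w (k y) / m (k y) * q y with hr
  have hr0 : ∀ y, 0 ≤ r y := fun y => mul_nonneg (div_nonneg (hw _) (hm0 _)) (hq.1 y)
  obtain ⟨f, hfS, hf⟩ := exists_filling hp.1 hr0 hτ (k := k) S (by
    intro y hy
    refine le_trans (le_of_eq ?_) (hfill (k y) (hk y hy))
    rw [← sum_fiberwise_of_maps_to (t := range (k y + 1)) (g := k)
      (by intro z hz; simp only [mem_filter] at hz; simp only [mem_range]; omega)]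
    refine sum_congr rfl fun i hi => ?_
    rw [mem_range] at hi
    have hiK : i < K := by have := hk y hy; omega
    have : ∑ z ∈ S.filter (fun z => k z ≤ k y) with k z = i, r z =
        ∑ z ∈ S with k z = i, w i / m i * q z := by
      rw [filter_filter]
      refine sum_congr ?_ fun z hz => ?_
      · ext z
        simp only [mem_filter]
        constructor
        · rintro ⟨h1, h2, h3⟩
          exact ⟨h1, h3⟩
        · rintro ⟨h1, h3⟩
          exact ⟨h1, by omega, h3⟩
      · simp only [mem_filter] at hz
        simp only [hr, hz.2]
    rw [this, ← mul_sum]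
    exact div_mul_cancel₀ _ (hpos i hiK).ne')
  obtain ⟨y₀⟩ : Nonempty Y := by
    rcases isEmpty_or_nonempty Y with h | h
    · exact absurd hq.2 (by simp)
    · exact h
  -- Atoms left over by the filling are all sent to y₀. This can only add mass, and it accounts for
  -- the extra storage element in `hM`.
  set g : X → Y := fun x => (f x).getD y₀ with hg
  refine le_trans ?_ (fidelity_pushforward_le_detFidelity hp hq g (insert y₀ S)
    ((card_insert_le _ _).trans hM) fun x => ?_)
  swap
  · rcases h : f x with _ | y
    · simp [hg, h]
    · simpa [hg, h] using Or.inr (hfS x y h)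
  have hpush : ∀ y ∈ S, (1 - η) * r y ≤ pushforward g p y := by
    intro y hy
    have h1 : ∑ x with f x = some y, p x ≤ pushforward g p y := by
      unfold pushforward
      refine sum_le_sum_of_subset_of_nonneg (fun x hx => ?_) fun x _ _ => hp.1 x
      simp only [mem_filter, mem_univ, true_and] at hx ⊢
      simp [hg, hx]
    rcases (hw (k y)).eq_or_lt with h0 | h0
    · have : r y = 0 := by simp [hr, ← h0]
      rw [this, mul_zero]
      exact pushforward_nonneg g hp.1 y
    · have h2 := (hf y hy).1
      -- Level masses are at most 1, so w q ≤ r and the filling deficit τ is at most the fraction η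
      -- of the bin.
      have h3 : τ (k y) ≤ η * r y := by
        refine (hsmall y hy h0).trans (mul_le_mul_of_nonneg_left ?_ hη0)
        simp only [hr]
        refine mul_le_mul_of_nonneg_right ?_ (hq.1 y)
        exact le_div_self h0.le (hpos _ (hk y hy)) (hm1 _)
      linarith
  calc √(1 - η) * ∑ j ∈ range K, √(w j) * √(m j)
      = ∑ j ∈ range K, ∑ y ∈ S with k y = j, √((1 - η) * r y) * √(q y) := by
        rw [mul_sum]
        refine sum_congr rfl fun j hj => ?_
        have hmj := hpos j (mem_range.1 hj)
        have : ∑ y ∈ S with k y = j, √((1 - η) * r y) * √(q y) =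
            ∑ y ∈ S with k y = j, √(1 - η) * √(w j / m j) * q y := by
          refine sum_congr rfl fun y hy => ?_
          simp only [mem_filter] at hy
          simp only [hr, hy.2]
          rw [Real.sqrt_mul (by linarith), Real.sqrt_mul (div_nonneg (hw _) (hm0 _)), mul_assoc,
            mul_assoc, Real.mul_self_sqrt (hq.1 y), mul_assoc]
        rw [this, ← mul_sum, mul_assoc, Real.sqrt_div (hw j)]
        congr 1
        change √(w j) * √(m j) = √(w j) / √(m j) * m j
        have hs : 0 < √(m j) := Real.sqrt_pos.2 hmj
        rw [div_mul_eq_mul_div, eq_div_iff hs.ne', mul_assoc, Real.mul_self_sqrt hmj.le]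
    _ = ∑ y ∈ S, √((1 - η) * r y) * √(q y) :=
        sum_fiberwise_of_maps_to (fun y hy => mem_range.2 (hk y hy)) _
    _ ≤ ∑ y ∈ S, √(pushforward g p y) * √(q y) := by
        refine sum_le_sum fun y hy => ?_
        exact mul_le_mul_of_nonneg_right (Real.sqrt_le_sqrt (hpush y hy)) (Real.sqrt_nonneg _)
    _ ≤ fidelity (pushforward g p) q := by
        refine sum_le_univ_sum_of_nonneg fun y => ?_
        exact mul_nonneg (Real.sqrt_nonneg _) (Real.sqrt_nonneg _)

/-- The level of `y`: the index of the interval of length `δ`, counted downwards from `s`, that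
contains the normalized self-information of `y`. -/
noncomputable def level (q : Y → ℝ) (a b s δ : ℝ) (y : Y) : ℕ :=
  ⌊(s - (-Real.logb 2 (q y) - a) / b) / δ⌋₊

omit [Fintype Y] in
theorem natCast_le_level_arg_iff {q : Y → ℝ} {a b s δ : ℝ} (hb : 0 < b) (hδ : 0 < δ) (y : Y)
    (m : ℝ) : m ≤ (s - (-Real.logb 2 (q y) - a) / b) / δ ↔
      -Real.logb 2 (q y) ≤ a + (s - m * δ) * b := by
  rw [le_div_iff₀ hδ, le_sub_comm, div_le_iff₀ hb, sub_le_iff_le_add']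

/-- Level 0 is excluded because the natural floor also sends all negative arguments to 0; every
other level is a genuine interval of self-information. -/
theorem sum_level_eq {q : Y → ℝ} (hq : ∀ y, 0 ≤ q y) {a b s δ : ℝ} (hb : 0 < b) (hδ : 0 < δ)
    {m : ℕ} (hm : m ≠ 0) :
    ∑ y with 0 < q y ∧ level q a b s δ y = m, q y =
      lowMass q (a + (s - m * δ) * b) - lowMass q (a + (s - (m + 1 : ℕ) * δ) * b) := by
  rw [eq_sub_iff_add_eq, lowMass, lowMass, sum_filter, sum_filter, sum_filter, ← sum_add_distrib]
  refine sum_congr rfl fun y _ => ?_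
  rcases (hq y).eq_or_lt with h0 | h0
  · simp [← h0]
  · have h1 := natCast_le_level_arg_iff (q := q) (a := a) (s := s) hb hδ y m
    have h2 := natCast_le_level_arg_iff (q := q) (a := a) (s := s) hb hδ y (m + 1 : ℕ)
    have h3 : (a + (s - (m + 1 : ℕ) * δ) * b) ≤ a + (s - m * δ) * b := by
      push_cast
      nlinarith [mul_pos hδ hb]
    have h5 : level q a b s δ y = m ↔ -Real.logb 2 (q y) ≤ a + (s - m * δ) * b ∧
        ¬ -Real.logb 2 (q y) ≤ a + (s - (m + 1 : ℕ) * δ) * b := by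
      rw [level, Nat.floor_eq_iff' hm, ← not_le, ← Nat.cast_succ, h1, Nat.succ_eq_add_one, h2]
    by_cases h4 : -Real.logb 2 (q y) ≤ a + (s - (m + 1 : ℕ) * δ) * b
    · simp only [h5, h4, h4.trans h3, not_true_eq_false, and_false, if_false, if_true, zero_add]
    · simp only [h5, h4, h0, not_false_eq_true, and_true, true_and, if_false, add_zero]

theorem tendsto_two_rpow_neg_mul_atTop {b : ℕ → ℝ} (hb : Tendsto b atTop atTop) {δ : ℝ}
    (hδ : 0 < δ) : Tendsto (fun n => (2 : ℝ) ^ (-(δ * b n))) atTop (𝓝 0) := by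
  have : Tendsto (fun n => δ * b n) atTop atTop := hb.const_mul_atTop hδ
  exact (tendsto_rpow_atBot_of_base_gt_one 2 (by norm_num)).comp
    (tendsto_neg_atTop_atBot.comp this)

theorem strictMono_stdNormalCDF : StrictMono stdNormalCDF :=
  strictMono_cdf_gaussianReal one_ne_zero

variable {𝒳 𝒴 : ℕ → Type*} [∀ n, Fintype (𝒳 n)] [∀ n, Fintype (𝒴 n)]

/-- The mass α j - α (j + 1) is sent to level j + 3 of the target, using source atoms of coordinate
above s - (j + 2)δ. These are smaller than the target atoms of that level by a factor 2^{-δ b_n}.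
Their mass suffices eventually, since Φ(s - (j + 2)δ) < Φ(s - (j + 1)δ) ≤ α (j + 1) is strict.
Target atoms of coordinate at most s - 3δ are few enough for the storage. -/
theorem eventually_lt_detFidelity_of_grid {p : ∀ n, 𝒳 n → ℝ} {q : ∀ n, 𝒴 n → ℝ}
    (hp : ∀ n, p n ∈ stdSimplex ℝ (𝒳 n)) (hq : ∀ n, q n ∈ stdSimplex ℝ (𝒴 n))
    {a b : ℕ → ℝ} (hb : Tendsto b atTop atTop)
    (hab : ∀ u, Tendsto (fun n => a n + u * b n) atTop atTop) {G : ℝ → ℝ} (hG : StrictMono G)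
    (hpl : ∀ u, Tendsto (fun n => lowMass (p n) (a n + u * b n)) atTop (𝓝 (stdNormalCDF u)))
    (hql : ∀ u, Tendsto (fun n => lowMass (q n) (a n + u * b n)) atTop (𝓝 (G u)))
    {M : ℕ → ℕ} {s : ℝ}
    (hM : Tendsto (fun n => (Real.logb 2 (M n) - a n) / b n) atTop (𝓝 s))
    {α : ℕ → ℝ} (hα : Antitone α) (hα0 : α 0 = 1) {δ : ℝ} (hδ : 0 < δ)
    (hΦ : ∀ j : ℕ, stdNormalCDF (s - j * δ) ≤ α j) {η : ℝ} (hη0 : 0 < η) (hη1 : η ≤ 1) (K : ℕ)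
    {c : ℝ} (hc : c < √(1 - η) * ∑ j ∈ range K, √(α j - α (j + 1)) *
      √(G (s - (j + 3 : ℕ) * δ) - G (s - (j + 4 : ℕ) * δ))) :
    ∀ᶠ n in atTop, c < detFidelity (p n) (q n) (M n) := by
  have hw : ∀ j, 0 ≤ α j - α (j + 1) := fun j => sub_nonneg.2 (hα (Nat.le_succ j))
  have hlt : ∀ i j : ℕ, i < j → s - j * δ < s - i * δ := by
    intro i j hij
    have : (i : ℝ) < j := by exact_mod_cast hij
    nlinarith
  have e1 : ∀ᶠ n in atTop, ∀ j ∈ range K,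
      lowMass (p n) (a n + (s - (j + 2 : ℕ) * δ) * b n) < α (j + 1) := by
    refine (eventually_all_finset _).2 fun j _ => (hpl _).eventually (gt_mem_nhds ?_)
    exact (strictMono_stdNormalCDF (hlt (j + 1) (j + 2) (by omega))).trans_le (hΦ (j + 1))
  have hcell : ∀ j : ℕ, Tendsto (fun n => lowMass (q n) (a n + (s - (j + 3 : ℕ) * δ) * b n) -
      lowMass (q n) (a n + (s - (j + 4 : ℕ) * δ) * b n)) atTop
      (𝓝 (G (s - (j + 3 : ℕ) * δ) - G (s - (j + 4 : ℕ) * δ))) :=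
    fun j => (hql _).sub (hql _)
  have e2 : ∀ᶠ n in atTop, ∀ j ∈ range K,
      0 < lowMass (q n) (a n + (s - (j + 3 : ℕ) * δ) * b n) -
        lowMass (q n) (a n + (s - (j + 4 : ℕ) * δ) * b n) :=
    (eventually_all_finset _).2 fun j _ => (hcell j).eventually
      (lt_mem_nhds (sub_pos.2 (hG (hlt (j + 3) (j + 4) (by omega)))))
  have e3 : ∀ᶠ n in atTop, ∀ j ∈ range K, 0 < α j - α (j + 1) →
      (2 : ℝ) ^ (-(δ * b n)) < η * (α j - α (j + 1)) := by
    refine (eventually_all_finset _).2 fun j _ => ?_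
    by_cases h : 0 < α j - α (j + 1)
    · filter_upwards [(tendsto_two_rpow_neg_mul_atTop hb hδ).eventually
        (gt_mem_nhds (mul_pos hη0 h))] with n hn _
      exact hn
    · exact Eventually.of_forall fun n hn => absurd hn h
  have e5 : ∀ᶠ n in atTop, c < √(1 - η) * ∑ j ∈ range K, √(α j - α (j + 1)) *
      √(lowMass (q n) (a n + (s - (j + 3 : ℕ) * δ) * b n) -
        lowMass (q n) (a n + (s - (j + 4 : ℕ) * δ) * b n)) := by
    refine Tendsto.eventually (Tendsto.const_mul _ (tendsto_finsetSum _ fun j _ => ?_))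
      (lt_mem_nhds hc)
    exact ((hcell j).sqrt).const_mul _
  filter_upwards [e1, e2, e3, e5, hb.eventually_gt_atTop 0, hb.eventually_ge_atTop (1 / (2 * δ)),
    (hab (s - 3 * δ)).eventually_ge_atTop 0, (hab (s - δ)).eventually_gt_atTop 0,
    hM.eventually (lt_mem_nhds (sub_lt_self s hδ))] with n h1 h2 h3 h5 hbn hbn' ha3 ha1 hMn
  set k : 𝒴 n → ℕ := level (q n) (a n) (b n) s δ with hk
  set S : Finset (𝒴 n) := {y | 0 < q n y ∧ 3 ≤ k y ∧ k y < K + 3} with hS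
  have hfib : ∀ j < K, ∑ y ∈ S with k y - 3 = j, q n y =
      lowMass (q n) (a n + (s - (j + 3 : ℕ) * δ) * b n) -
        lowMass (q n) (a n + (s - (j + 4 : ℕ) * δ) * b n) := by
    intro j hj
    rw [← sum_level_eq (hq n).1 hbn hδ (by omega : j + 3 ≠ 0), hS, filter_filter]
    refine sum_congr ?_ fun _ _ => rfl
    ext y
    simp only [mem_filter, mem_univ, true_and]
    rw [and_assoc]
    refine and_congr_right fun _ => ?_
    change _ ↔ k y = j + 3
    omega
  have hlow : ∀ y ∈ S, -Real.logb 2 (q n y) ≤ a n + (s - (k y : ℕ) * δ) * b n := by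
    intro y hy
    simp only [hS, mem_filter, mem_univ, true_and] at hy
    rw [← natCast_le_level_arg_iff hbn hδ]
    exact Nat.floor_le (by
      by_contra hneg
      have : k y = 0 := Nat.floor_of_nonpos (not_le.1 hneg).le
      omega)
  have hpowM : (2 : ℝ) ^ (a n + (s - δ) * b n) ≤ M n := by
    rw [lt_div_iff₀ hbn] at hMn
    have h6 : a n + (s - δ) * b n < Real.logb 2 (M n) := by linarith
    have hM0 : 0 < (M n : ℝ) := by
      -- An empty storage would give `logb 2 0 = 0`, below the positive number a n + (s - δ) b n.
      rcases Nat.eq_zero_or_pos (M n) with h | h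
      · rw [h, Nat.cast_zero, Real.logb_zero] at h6
        linarith
      · exact_mod_cast h
    exact ((Real.lt_logb_iff_rpow_lt (by norm_num) hM0).1 h6).le
  have hcard : #S + 1 ≤ M n := by
    have h6 : (#S : ℝ) ≤ 2 ^ (a n + (s - 3 * δ) * b n) := by
      refine le_trans ?_ (card_filter_le_rpow (hq n) _)
      refine Nat.cast_le.2 (card_le_card fun y hy => ?_)
      have h7 := hlow y hy
      simp only [hS, mem_filter, mem_univ, true_and] at hy ⊢
      refine ⟨hy.1, h7.trans ?_⟩
      have : (3 : ℝ) ≤ k y := by exact_mod_cast hy.2.1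
      gcongr
    have h7 : (1 : ℝ) ≤ 2 ^ (a n + (s - 3 * δ) * b n) := Real.one_le_rpow (by norm_num) ha3
    -- The gap 2δ b_n ≥ 1 in the exponent gains the factor 2 that absorbs the additional element.
    have h8 : (2 : ℝ) * 2 ^ (a n + (s - 3 * δ) * b n) ≤ 2 ^ (a n + (s - δ) * b n) := by
      rw [← Real.rpow_one_add' (by norm_num) (by positivity)]
      refine Real.rpow_le_rpow_of_exponent_le (by norm_num) ?_
      rw [div_le_iff₀ (by positivity)] at hbn'
      nlinarith
    have : ((#S + 1 : ℕ) : ℝ) ≤ (M n : ℝ) := by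
      push_cast
      linarith
    exact_mod_cast this
  refine h5.trans_le ?_
  have key := le_detFidelity_of_levels (hp n) (hq n) (M := M n) (K := K)
    (w := fun j => α j - α (j + 1))
    (τ := fun j => (2 : ℝ) ^ (-(a n + (s - (j + 2 : ℕ) * δ) * b n))) (η := η) hw
    (fun j => by positivity) S (fun y => k y - 3) ?_ ?_ ?_ ?_ hη0.le hη1 hcard
  · refine le_trans (le_of_eq ?_) key
    congr 1
    refine sum_congr rfl fun j hj => ?_
    rw [hfib j (mem_range.1 hj)]
  · intro y hy
    simp only [hS, mem_filter, mem_univ, true_and] at hy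
    omega
  · intro j hj
    rw [hfib j hj]
    exact h2 j (mem_range.2 hj)
  · intro j hj
    refine le_trans ?_ (one_sub_lowMass_le (hp n) _)
    rw [sum_range_sub', hα0]
    have := h1 j (mem_range.2 hj)
    linarith
  · intro y hy hwy
    have hlow' := hlow y hy
    simp only [hS, mem_filter, mem_univ, true_and] at hy
    set j := k y - 3 with hj
    have hkj : k y = j + 3 := by omega
    have h6 := (h3 j (mem_range.2 (by omega)) hwy).le
    rw [hkj] at hlow'
    have h7 : (2 : ℝ) ^ (-(a n + (s - (j + 3 : ℕ) * δ) * b n)) ≤ q n y := by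
      rw [← Real.le_logb_iff_rpow_le (by norm_num) hy.1]
      linarith
    have h8 : (2 : ℝ) ^ (-(a n + (s - (j + 2 : ℕ) * δ) * b n)) =
        2 ^ (-(δ * b n)) * 2 ^ (-(a n + (s - (j + 3 : ℕ) * δ) * b n)) := by
      rw [← Real.rpow_add (by norm_num)]
      congr 1
      push_cast
      ring
    rw [h8, ← mul_assoc]
    exact mul_le_mul h6 h7 (by positivity) (by positivity)

end Achievability

end RNC

namespace RNC

open MeasureTheory ProbabilityTheory Set
open scoped NNReal

/-! ### The continuous fidelity and its bound by cell masses. -/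

section ContFidelity

theorem setIntegral_sqrt_mul_le {f g : ℝ → ℝ} {S : Set ℝ} (hf : ∀ x, 0 ≤ f x)
    (hg : ∀ x, 0 ≤ g x) (hfi : IntegrableOn f S) (hgi : IntegrableOn g S) :
    ∫ x in S, √(f x * g x) ≤ √(∫ x in S, f x) * √(∫ x in S, g x) := by
  have hL : ∀ {h : ℝ → ℝ}, (∀ x, 0 ≤ h x) → IntegrableOn h S →
      MemLp (fun x => √(h x)) (ENNReal.ofReal 2) (volume.restrict S) := by
    intro h h0 hi
    rw [ENNReal.ofReal_ofNat, memLp_two_iff_integrable_sq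
      (Real.continuous_sqrt.comp_aestronglyMeasurable hi.aestronglyMeasurable)]
    exact hi.congr (Eventually.of_forall fun x => (Real.sq_sqrt (h0 x)).symm)
  have := integral_mul_le_Lp_mul_Lq_of_nonneg (μ := volume.restrict S)
    Real.HolderConjugate.two_two
    (Eventually.of_forall fun x => Real.sqrt_nonneg (f x))
    (Eventually.of_forall fun x => Real.sqrt_nonneg (g x)) (hL hf hfi) (hL hg hgi)
  simp only [Real.rpow_two, Real.sq_sqrt (hf _), Real.sq_sqrt (hg _), ← Real.sqrt_eq_rpow] at this
  simpa only [Real.sqrt_mul (hf _)] using this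

variable {A : ℝ → ℝ} {s μ : ℝ} {v : ℝ≥0}

/-- A is increasing with values in [0, 1], so the integral of its derivative over any bounded
interval is at most 1. -/
theorem integrable_deriv_of_admissible (hA : A ∈ admissibleCDF s) : Integrable (deriv A) := by
  obtain ⟨hc, hm, -, hb⟩ := hA
  have hcont : Continuous (deriv A) := hc.continuous_deriv le_rfl
  have hd : ∀ x, HasDerivAt A (deriv A x) x :=
    fun x => (hc.differentiable one_ne_zero x).hasDerivAt
  have h0 : ∀ x, 0 ≤ deriv A x := fun x => hm.deriv_nonneg
  refine integrable_of_intervalIntegral_norm_bounded (a := fun n : ℕ => -(n : ℝ))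
    (b := fun n : ℕ => (n : ℝ)) (l := atTop) 1 (fun n => hcont.integrableOn_Ioc)
    (tendsto_neg_atTop_atBot.comp tendsto_natCast_atTop_atTop) tendsto_natCast_atTop_atTop
    (Eventually.of_forall fun n => ?_)
  simp only [Real.norm_of_nonneg (h0 _)]
  rw [intervalIntegral.integral_eq_sub_of_hasDerivAt (fun x _ => hd x)
    (hcont.intervalIntegrable _ _)]
  have h1 := (hb n).2
  have h2 : 0 ≤ A (-n) := (cdf_nonneg _ _).trans (hb (-n)).1
  linarith

theorem setIntegral_Ioc_deriv (hA : A ∈ admissibleCDF s) {x y : ℝ} (hxy : x ≤ y) :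
    ∫ t in Ioc x y, deriv A t = A y - A x := by
  rw [← intervalIntegral.integral_of_le hxy]
  exact intervalIntegral.integral_eq_sub_of_hasDerivAt
    (fun t _ => (hA.1.differentiable one_ne_zero t).hasDerivAt)
    ((hA.1.continuous_deriv le_rfl).intervalIntegrable _ _)

theorem setIntegral_deriv_le_one (hA : A ∈ admissibleCDF s) (S : Set ℝ) :
    ∫ t in S, deriv A t ≤ 1 := by
  have h0 : ∀ x, 0 ≤ deriv A x := fun x => hA.2.1.deriv_nonneg
  refine (setIntegral_le_integral (integrable_deriv_of_admissible hA)
    (Eventually.of_forall h0)).trans ?_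
  have h1 : Tendsto (fun n : ℕ => ∫ t in (-(n : ℝ))..n, deriv A t) atTop (𝓝 (∫ t, deriv A t)) :=
    intervalIntegral_tendsto_integral (integrable_deriv_of_admissible hA)
      (tendsto_neg_atTop_atBot.comp tendsto_natCast_atTop_atTop) tendsto_natCast_atTop_atTop
  refine le_of_tendsto h1 (Eventually.of_forall fun n => ?_)
  have hn : -(n : ℝ) ≤ n := by
    have : (0 : ℝ) ≤ n := n.cast_nonneg
    linarith
  rw [intervalIntegral.integral_of_le hn, setIntegral_Ioc_deriv hA hn]
  have h1 := (hA.2.2.2 n).2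
  have h2 : 0 ≤ A (-n) := (cdf_nonneg _ _).trans (hA.2.2.2 (-n)).1
  linarith

theorem integrable_sqrt_deriv_mul (hA : A ∈ admissibleCDF s) :
    Integrable fun x => √(deriv A x * gaussianPDFReal μ v x) := by
  have h0 : ∀ x, 0 ≤ deriv A x := fun x => hA.2.1.deriv_nonneg
  refine ((integrable_deriv_of_admissible hA).add (integrable_gaussianPDFReal μ v)).mono'
    ((hA.1.continuous_deriv le_rfl).mul continuous_gaussianPDFReal).sqrt.aestronglyMeasurable
    (Eventually.of_forall fun x => ?_)
  have h1 := gaussianPDFReal_nonneg μ v x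
  rw [Real.norm_of_nonneg (Real.sqrt_nonneg _), Pi.add_apply]
  refine Real.sqrt_le_iff.2 ⟨add_nonneg (h0 x) h1, ?_⟩
  nlinarith [h0 x, mul_nonneg (h0 x) h1, sq_nonneg (deriv A x), sq_nonneg (gaussianPDFReal μ v x)]

theorem contFidelity_nonneg (f g : ℝ → ℝ) : 0 ≤ contFidelity f g :=
  integral_nonneg fun _ => Real.sqrt_nonneg _

theorem contFidelity_le_one (hv : v ≠ 0) (hA : A ∈ admissibleCDF s) :
    contFidelity (deriv A) (gaussianPDFReal μ v) ≤ 1 := by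
  have h0 : ∀ x, 0 ≤ deriv A x := fun x => hA.2.1.deriv_nonneg
  have := setIntegral_sqrt_mul_le (S := univ) h0 (gaussianPDFReal_nonneg μ v)
    (integrable_deriv_of_admissible hA).integrableOn (integrable_gaussianPDFReal μ v).integrableOn
  have h1 := setIntegral_deriv_le_one hA univ
  simp only [Measure.restrict_univ] at this h1
  rw [integral_gaussianPDFReal_eq_one μ hv, Real.sqrt_one, mul_one] at this
  exact this.trans (Real.sqrt_le_one.2 h1)

/-- Upper bound on the continuous fidelity by cell masses on a grid below `s`. -/
theorem contFidelity_le_sum_grid (hv : v ≠ 0) (hA : A ∈ admissibleCDF s) {δ : ℝ} (hδ : 0 < δ)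
    (K : ℕ) :
    contFidelity (deriv A) (gaussianPDFReal μ v) ≤
      (∑ j ∈ Finset.range K, √(A (s - j * δ) - A (s - (j + 1 : ℕ) * δ)) *
        √(cdf (gaussianReal μ v) (s - j * δ) - cdf (gaussianReal μ v) (s - (j + 1 : ℕ) * δ))) +
      √(cdf (gaussianReal μ v) (s - K * δ)) := by
  have h0 : ∀ x, 0 ≤ deriv A x := fun x => hA.2.1.deriv_nonneg
  set F : ℝ → ℝ := fun x => √(deriv A x * gaussianPDFReal μ v x) with hF
  have hFi : Integrable F := integrable_sqrt_deriv_mul hA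
  have hAi := integrable_deriv_of_admissible hA
  have hNi := integrable_gaussianPDFReal μ v
  have hN0 := gaussianPDFReal_nonneg μ v
  have hone : ∀ x, s ≤ x → A x = 1 := fun x hx =>
    le_antisymm (hA.2.2.2 x).2 (hA.2.2.1 ▸ hA.2.1 hx)
  -- To the right of s the function A is constantly 1, so only the half-line below s contributes.
  have htop : ∫ x in Ioi s, F x = 0 := by
    refine setIntegral_eq_zero_of_forall_eq_zero fun x hx => ?_
    have : deriv A x = 0 := by
      have : A =ᶠ[𝓝 x] fun _ => 1 := by
        filter_upwards [Ioi_mem_nhds hx] with y hy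
        exact hone y (le_of_lt hy)
      rw [this.deriv_eq, deriv_const]
    simp [hF, this]
  have hstart : contFidelity (deriv A) (gaussianPDFReal μ v) = ∫ x in Iic s, F x := by
    have := intervalIntegral.integral_Iic_add_Ioi (b := s) hFi.integrableOn hFi.integrableOn
    rw [htop, add_zero] at this
    exact this.symm
  have hstep : ∀ K : ℕ, ∫ x in Iic s, F x ≤
      (∑ j ∈ Finset.range K, √(A (s - j * δ) - A (s - (j + 1 : ℕ) * δ)) *
        √(cdf (gaussianReal μ v) (s - j * δ) - cdf (gaussianReal μ v) (s - (j + 1 : ℕ) * δ))) +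
      ∫ x in Iic (s - K * δ), F x := by
    intro K
    induction K with
    | zero => simp
    | succ K ih =>
      rw [Finset.sum_range_succ]
      have hle : s - (K + 1 : ℕ) * δ ≤ s - K * δ := by push_cast; linarith
      have hsplit : ∫ x in Iic (s - K * δ), F x =
          (∫ x in Iic (s - (K + 1 : ℕ) * δ), F x) +
            ∫ x in Ioc (s - (K + 1 : ℕ) * δ) (s - K * δ), F x := by
        rw [← Iic_union_Ioc_eq_Iic hle]
        exact setIntegral_union (Iic_disjoint_Ioc le_rfl) measurableSet_Ioc hFi.integrableOn
          hFi.integrableOn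
      have hcs := setIntegral_sqrt_mul_le (S := Ioc (s - (K + 1 : ℕ) * δ) (s - K * δ)) h0 hN0
        hAi.integrableOn hNi.integrableOn
      rw [setIntegral_Ioc_deriv hA hle,
        ← intervalIntegral.integral_of_le (f := gaussianPDFReal μ v) hle, ← cdf_gaussianReal_sub hv] at hcs
      rw [hsplit] at ih
      rw [hF] at ih ⊢
      linarith
  rw [hstart]
  refine (hstep K).trans (add_le_add_right ?_ _)
  have hcs := setIntegral_sqrt_mul_le (S := Iic (s - K * δ)) h0 hN0
    hAi.integrableOn hNi.integrableOn
  rw [← cdf_gaussianReal_eq_integral hv] at hcs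
  refine hcs.trans (mul_le_of_le_one_left (Real.sqrt_nonneg _) ?_)
  exact Real.sqrt_le_one.2 (setIntegral_deriv_le_one hA _)

end ContFidelity

/-! ### Control of the discretization error. -/

section GridError

theorem sum_sqrt_le_sqrt_card {w : ℕ → ℝ} (hw : ∀ j, 0 ≤ w j) {K : ℕ}
    (h1 : ∑ j ∈ Finset.range K, w j ≤ 1) : ∑ j ∈ Finset.range K, √(w j) ≤ √K := by
  have := Real.sum_sqrt_mul_sqrt_le (Finset.range K) hw (g := fun _ => 1) fun _ => zero_le_one
  simp only [Real.sqrt_one, mul_one, Finset.sum_const, Finset.card_range, nsmul_eq_mul] at this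
  exact this.trans (mul_le_of_le_one_left (Real.sqrt_nonneg _) (Real.sqrt_le_one.2 h1))

/-- An error κ per cell costs κ∑√w_j ≤ κ√K. For κ of order δ√δ this is of order δ√(Kδ), which
vanishes when the mesh is refined at fixed length Kδ. -/
theorem sum_sqrt_mul_le_add {w : ℕ → ℝ} (hw : ∀ j, 0 ≤ w j) {K : ℕ}
    (h1 : ∑ j ∈ Finset.range K, w j ≤ 1) {f g : ℕ → ℝ} {κ : ℝ} (hκ : 0 ≤ κ)
    (hfg : ∀ j < K, f j ≤ g j + κ) :
    ∑ j ∈ Finset.range K, √(w j) * f j ≤ ∑ j ∈ Finset.range K, √(w j) * g j + κ * √K := by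
  calc ∑ j ∈ Finset.range K, √(w j) * f j
      ≤ ∑ j ∈ Finset.range K, (√(w j) * g j + κ * √(w j)) := by
        refine Finset.sum_le_sum fun j hj => ?_
        have := mul_le_mul_of_nonneg_left (hfg j (Finset.mem_range.1 hj)) (Real.sqrt_nonneg (w j))
        linarith
    _ ≤ _ := by
        rw [Finset.sum_add_distrib, ← Finset.mul_sum]
        exact add_le_add_right (mul_le_mul_of_nonneg_left (sum_sqrt_le_sqrt_card hw h1) hκ) _

theorem exists_sqrt_cdf_sub_eq {μ : ℝ} {v : ℝ≥0} (hv : v ≠ 0) {x y δ : ℝ} (hδ : 0 < δ)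
    (hxy : y = x + δ) : ∃ ξ ∈ Ioo x y,
      √(cdf (gaussianReal μ v) y - cdf (gaussianReal μ v) x) = √δ * √(gaussianPDFReal μ v ξ) := by
  obtain ⟨ξ, hξ, h⟩ := exists_cdf_gaussianReal_sub_eq (μ := μ) hv (show x < y by linarith)
  refine ⟨ξ, hξ, ?_⟩
  rw [h, show y - x = δ by linarith, Real.sqrt_mul hδ.le]

/-- A mesh that is fine and extends far to the left. -/
theorem exists_grid {G : ℝ → ℝ} (hG : Tendsto G atBot (𝓝 0)) (C s : ℝ) {ε : ℝ} (hε : 0 < ε) :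
    ∃ (K : ℕ) (δ : ℝ), 0 < δ ∧ √(G (s - K * δ)) ≤ ε ∧ √(G (s - (K - 1) * δ)) ≤ ε ∧
      C * δ * √δ * √K ≤ ε := by
  have h1 : Tendsto (fun x => √(G x)) atBot (𝓝 0) := by simpa using hG.sqrt
  obtain ⟨B, hB⟩ := eventually_atBot.1 (h1.eventually (ge_mem_nhds hε))
  -- R = Kδ is the length of the grid. The summand 1 leaves room for the endpoint s - (K - 1)δ,
  -- because δ ≤ 1.
  set R : ℝ := max (s - B) 0 + 1 with hR
  have hR1 : 1 ≤ R := by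
    rw [hR]
    linarith [le_max_right (s - B) 0]
  have hRB : s - R + 1 ≤ B := by
    rw [hR]
    linarith [le_max_left (s - B) 0]
  obtain ⟨K, hK⟩ := exists_nat_gt (max R (|C| * R * √R / ε))
  have hKR : R < K := (le_max_left _ _).trans_lt hK
  have hK0 : (0 : ℝ) < K := by linarith
  have hKC : |C| * R * √R / ε < K := (le_max_right _ _).trans_lt hK
  have hR0 : 0 < R := by linarith
  refine ⟨K, R / K, by positivity, hB _ ?_, hB _ ?_, ?_⟩
  · rw [mul_div_cancel₀ _ hK0.ne']
    linarith
  · have : ((K : ℝ) - 1) * (R / K) = R - R / K := by field_simp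
    rw [this]
    have : R / K ≤ 1 := (div_le_one hK0).2 hKR.le
    linarith
  · rw [mul_assoc, ← Real.sqrt_mul (by positivity), div_mul_cancel₀ _ hK0.ne']
    rw [div_lt_iff₀ hε] at hKC
    have : C * (R / K) * √R ≤ |C| * (R / K) * √R := by
      gcongr
      exact le_abs_self C
    refine this.trans ?_
    rw [show |C| * (R / K) * √R = |C| * R * √R / K by ring, div_le_iff₀ hK0]
    linarith

end GridError

end RNC

namespace RNC

open MeasureTheory ProbabilityTheory
open scoped NNReal

/-! ### The lower bound for deterministic conversions. -/

section AchievabilityLimit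

variable {𝒳 𝒴 : ℕ → Type*} [∀ n, Fintype (𝒳 n)] [∀ n, Fintype (𝒴 n)]

theorem eventually_lt_detFidelity {p : ∀ n, 𝒳 n → ℝ} {q : ∀ n, 𝒴 n → ℝ}
    (hp : ∀ n, p n ∈ stdSimplex ℝ (𝒳 n)) (hq : ∀ n, q n ∈ stdSimplex ℝ (𝒴 n))
    {a b : ℕ → ℝ} (hb : Tendsto b atTop atTop)
    (hab : ∀ u, Tendsto (fun n => a n + u * b n) atTop atTop) {μ : ℝ} {v : ℝ≥0} (hv : v ≠ 0)
    (hpl : ∀ u, Tendsto (fun n => lowMass (p n) (a n + u * b n)) atTop (𝓝 (stdNormalCDF u)))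
    (hql : ∀ u, Tendsto (fun n => lowMass (q n) (a n + u * b n)) atTop
      (𝓝 (cdf (gaussianReal μ v) u)))
    {M : ℕ → ℕ} {s : ℝ}
    (hM : Tendsto (fun n => (Real.logb 2 (M n) - a n) / b n) atTop (𝓝 s))
    {A : ℝ → ℝ} (hA : A ∈ admissibleCDF s) {c : ℝ}
    (hc : c < contFidelity (deriv A) (gaussianPDFReal μ v)) :
    ∀ᶠ n in atTop, c < detFidelity (p n) (q n) (M n) := by
  obtain ⟨L, hL0, hL⟩ := exists_lipschitz_sqrt_gaussianPDFReal (μ := μ) hv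
  -- One ε pays for the tail below the grid and one for the shift by three cells (points of the two
  -- cells are within 4δ); the third keeps B strictly above c.
  set ε := (contFidelity (deriv A) (gaussianPDFReal μ v) - c) / 3 with hε
  have hε0 : 0 < ε := by rw [hε]; linarith
  obtain ⟨K, δ, hδ, hG1, -, hmesh⟩ :=
    exists_grid (tendsto_cdf_atBot (gaussianReal μ v)) (4 * L) s hε0
  set α : ℕ → ℝ := fun j => A (s - j * δ) with hα
  have hαanti : Antitone α := fun i j hij => hA.2.1 (by
    have : (i : ℝ) ≤ j := by exact_mod_cast hij
    nlinarith)
  have hα0 : α 0 = 1 := by simp [hα, hA.2.2.1]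
  have hw : ∀ j, 0 ≤ α j - α (j + 1) := fun j => sub_nonneg.2 (hαanti (Nat.le_succ j))
  have hw1 : ∑ j ∈ Finset.range K, (α j - α (j + 1)) ≤ 1 := by
    rw [Finset.sum_range_sub', hα0]
    have : 0 ≤ α K := (cdf_nonneg _ _).trans (hA.2.2.2 _).1
    linarith
  have hgrid := contFidelity_le_sum_grid (μ := μ) hv hA hδ K
  have hshift := sum_sqrt_mul_le_add hw hw1
    (f := fun j => √(cdf (gaussianReal μ v) (s - j * δ) -
      cdf (gaussianReal μ v) (s - (j + 1 : ℕ) * δ)))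
    (g := fun j => √(cdf (gaussianReal μ v) (s - (j + 3 : ℕ) * δ) -
      cdf (gaussianReal μ v) (s - (j + 4 : ℕ) * δ)))
    (κ := 4 * L * δ * √δ) (by positivity) (by
      intro j _
      obtain ⟨ξ, hξ, h1⟩ := exists_sqrt_cdf_sub_eq (μ := μ) hv hδ
        (show s - j * δ = s - (j + 1 : ℕ) * δ + δ by push_cast; ring)
      obtain ⟨ζ, hζ, h2⟩ := exists_sqrt_cdf_sub_eq (μ := μ) hv hδ
        (show s - (j + 3 : ℕ) * δ = s - (j + 4 : ℕ) * δ + δ by push_cast; ring)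
      rw [h1, h2]
      have hdist : |ξ - ζ| ≤ 4 * δ := by
        obtain ⟨h3, h4⟩ := hξ
        obtain ⟨h5, h6⟩ := hζ
        push_cast at h3 h4 h5 h6
        rw [abs_le]
        constructor <;> linarith
      have h3 := (abs_le.1 (hL ξ ζ)).2
      have h4 : L * |ξ - ζ| ≤ L * (4 * δ) := mul_le_mul_of_nonneg_left hdist hL0
      have h5 : √δ * √(gaussianPDFReal μ v ξ) ≤
          √δ * (√(gaussianPDFReal μ v ζ) + L * (4 * δ)) :=
        mul_le_mul_of_nonneg_left (by linarith) (Real.sqrt_nonneg _)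
      linarith)
  set B := ∑ j ∈ Finset.range K, √(α j - α (j + 1)) *
      √(cdf (gaussianReal μ v) (s - (j + 3 : ℕ) * δ) -
      cdf (gaussianReal μ v) (s - (j + 4 : ℕ) * δ)) with hS
  have hS0 : c < B := by linarith
  obtain ⟨η, hη, hη0, hη1⟩ : ∃ η : ℝ, c < √(1 - η) * B ∧ 0 < η ∧ η ≤ 1 := by
    have hcont : Tendsto (fun η : ℝ => √(1 - η) * B) (𝓝[>] 0) (𝓝 (√(1 - 0) * B)) :=
      ((Continuous.tendsto (by fun_prop) 0).mono_left nhdsWithin_le_nhds)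
    rw [sub_zero, Real.sqrt_one, one_mul] at hcont
    have h1 : ∀ᶠ η : ℝ in 𝓝[>] 0, η ≤ 1 :=
      (ge_mem_nhds (zero_lt_one (α := ℝ))).filter_mono nhdsWithin_le_nhds
    obtain ⟨η, h2, h3, h4⟩ := ((hcont.eventually (lt_mem_nhds hS0)).and
      (h1.and self_mem_nhdsWithin)).exists
    exact ⟨η, h2, h4, h3⟩
  exact eventually_lt_detFidelity_of_grid hp hq hb hab (strictMono_cdf_gaussianReal hv) hpl hql hM
    hαanti hα0 hδ (fun j => (hA.2.2.2 _).1) hη0 hη1 K hη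

end AchievabilityLimit

/-! ### From grid masses back to an admissible function. -/

section Interpolation

/-- Smooth interpolation of the masses of grid cells by an admissible distribution function. -/
theorem exists_admissible_interpolation {s δ η μ : ℝ} {v : ℝ≥0} (hδ : 0 < δ) (hη : 0 < η)
    (hη' : η < 1 / 2) {K : ℕ} {α c : ℕ → ℝ} (hα : Antitone α) (hα0 : α 0 = 1)
    (hΦ : ∀ j ≤ K, stdNormalCDF (s - j * δ) ≤ α j) (hc : ∀ j < K, 0 ≤ c j)
    (hcg : ∀ j < K, ∀ x ∈ Set.Ioc (s - (j + 2 : ℕ) * δ) (s - (j + 1 : ℕ) * δ),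
      c j ≤ √(gaussianPDFReal μ v x)) :
    ∃ A ∈ admissibleCDF s, (1 - 2 * η) * ∑ j ∈ Finset.range K, √(α j - α (j + 1)) * (√δ * c j) ≤
      contFidelity (deriv A) (gaussianPDFReal μ v) := by
  obtain ⟨Ψ, ψ, hΨ, hψc, hψ0, hΨ0, hΨ1, hI⟩ := exists_smooth_step hη hη'
  have hΨm : Monotone Ψ := monotone_of_hasDerivAt_nonneg hΨ hψ0
  have hΨnn : ∀ x, 0 ≤ Ψ x := fun x =>
    (hΨ0 (min x 0) (min_le_right _ _)).symm.trans_le (hΨm (min_le_left _ _))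
  have hΨle : ∀ x, Ψ x ≤ 1 := fun x =>
    (hΨm (le_max_left x 1)).trans_eq (hΨ1 _ (le_max_right _ _))
  set w : ℕ → ℝ := fun j => α j - α (j + 1) with hwdef
  have hw : ∀ j, 0 ≤ w j := fun j => sub_nonneg.2 (hα (Nat.le_succ j))
  -- The mass w j is spread one cell to the left of its place, so that A reaches α j already at s -
  -- (j + 1)δ; this secures Φ ≤ A between grid points. The remainder α K stays at -∞, as admissible
  -- functions need not tend to 0 there.
  set A : ℝ → ℝ := fun x => α K +
    ∑ j ∈ Finset.range K, w j * Ψ ((x - (s - (j + 2 : ℕ) * δ)) / δ) with hAdef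
  set A' : ℝ → ℝ := fun x =>
    ∑ j ∈ Finset.range K, w j * (ψ ((x - (s - (j + 2 : ℕ) * δ)) / δ) * (1 / δ)) with hA'def
  have hder : ∀ x, HasDerivAt A (A' x) x := by
    intro x
    refine HasDerivAt.const_add _ (HasDerivAt.fun_sum fun j _ => HasDerivAt.const_mul _ ?_)
    exact (hΨ _).comp x (((hasDerivAt_id x).sub_const _).div_const δ)
  have hA'0 : ∀ x, 0 ≤ A' x := fun x => Finset.sum_nonneg fun j _ =>
    mul_nonneg (hw j) (mul_nonneg (hψ0 _) (by positivity))
  have hA'c : Continuous A' := by fun_prop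
  have hderiv : deriv A = A' := funext fun x => (hder x).deriv
  have hterm : ∀ x j, 0 ≤ w j * Ψ ((x - (s - (j + 2 : ℕ) * δ)) / δ) :=
    fun x j => mul_nonneg (hw j) (hΨnn _)
  -- The steps of index j ≥ m are complete at x, and their heights telescope to α m - α K.
  have hlow : ∀ m ≤ K, ∀ x, (s - (m + 1 : ℕ) * δ ≤ x ∨ m = K) → α m ≤ A x := by
    intro m hm x hx
    rcases hx with hx | rfl
    · have : ∀ k, m ≤ k → α m - α k ≤
          ∑ j ∈ Finset.range k, w j * Ψ ((x - (s - (j + 2 : ℕ) * δ)) / δ) := by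
        intro k hk
        induction k, hk using Nat.le_induction with
        | base =>
          rw [sub_self]
          exact Finset.sum_nonneg fun j _ => hterm x j
        | succ k hk ih =>
          rw [Finset.sum_range_succ, hΨ1 ((x - (s - (k + 2 : ℕ) * δ)) / δ), mul_one]
          · simp only [hwdef] at ih ⊢
            linarith
          · rw [one_le_div hδ]
            have : (m : ℝ) ≤ k := by exact_mod_cast hk
            push_cast at hx ⊢
            nlinarith
      have := this K hm
      simp only [hAdef]
      linarith
    · exact le_add_of_nonneg_right (Finset.sum_nonneg fun j _ => hterm x j)
  have hA1 : ∀ x, A x ≤ 1 := by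
    intro x
    have : ∑ j ∈ Finset.range K, w j * Ψ ((x - (s - (j + 2 : ℕ) * δ)) / δ) ≤
        ∑ j ∈ Finset.range K, w j :=
      Finset.sum_le_sum fun j _ => mul_le_of_le_one_right (hw j) (hΨle _)
    rw [Finset.sum_range_sub', hα0] at this
    simp only [hAdef]
    linarith
  have hAadm : A ∈ admissibleCDF s := by
    refine ⟨?_, monotone_of_hasDerivAt_nonneg hder hA'0, ?_, fun x => ⟨?_, hA1 x⟩⟩
    · rw [contDiff_one_iff_deriv, hderiv]
      exact ⟨fun x => (hder x).differentiableAt, hA'c⟩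
    · refine le_antisymm (hA1 s) (hα0 ▸ hlow 0 (Nat.zero_le _) s (Or.inl ?_))
      push_cast
      linarith
    · have hex : ∃ m : ℕ, s - (m + 1 : ℕ) * δ ≤ x ∨ m = K := ⟨K, Or.inr rfl⟩
      classical
      have hmK : Nat.find hex ≤ K := Nat.find_min' hex (Or.inr rfl)
      have hm := Nat.find_spec hex
      have hmin := fun i => Nat.find_min hex (m := i)
      set m := Nat.find hex
      refine le_trans ?_ (hlow m hmK x hm)
      rcases Nat.eq_zero_or_pos m with h0 | h0
      · rw [h0, hα0]
        exact cdf_le_one _ _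
      · refine le_trans ?_ (hΦ m hmK)
        have := hmin (m - 1) (by omega)
        rw [not_or, not_le, Nat.sub_add_cancel h0] at this
        exact strictMono_stdNormalCDF.monotone this.1.le
  refine ⟨A, hAadm, ?_⟩
  set F : ℝ → ℝ := fun x => √(deriv A x * gaussianPDFReal μ v x) with hF
  have hFi : Integrable F := integrable_sqrt_deriv_mul hAadm
  have hF0 : ∀ x, 0 ≤ F x := fun x => Real.sqrt_nonneg _
  have hcell : ∀ j < K, (1 - 2 * η) * (√(w j) * (√δ * c j)) ≤
      ∫ x in (s - (j + 2 : ℕ) * δ)..(s - (j + 1 : ℕ) * δ), F x := by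
    intro j hj
    have hle : s - (j + 2 : ℕ) * δ ≤ s - (j + 1 : ℕ) * δ := by push_cast; linarith
    have h1 : ∫ x in (s - (j + 2 : ℕ) * δ)..(s - (j + 1 : ℕ) * δ),
        √(ψ ((x - (s - (j + 2 : ℕ) * δ)) / δ)) = δ * ∫ x in (0 : ℝ)..1, √(ψ x) := by
      have h2 := intervalIntegral.integral_comp_sub_right
        (a := s - (j + 2 : ℕ) * δ) (b := s - (j + 1 : ℕ) * δ) (fun x => √(ψ (x / δ)))
        (s - (j + 2 : ℕ) * δ)
      rw [h2, sub_self, show s - (j + 1 : ℕ) * δ - (s - (j + 2 : ℕ) * δ) = δ by push_cast; ring,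
        intervalIntegral.integral_comp_div (fun x => √(ψ x)) hδ.ne', zero_div, div_self hδ.ne',
        smul_eq_mul]
    have hs : √(w j / δ) * c j * δ = √(w j) * (√δ * c j) := by
      rw [Real.sqrt_div (hw j)]
      have : 0 < √δ := Real.sqrt_pos.2 hδ
      have h3 : √δ * √δ = δ := Real.mul_self_sqrt hδ.le
      field_simp
      linear_combination (-(√(w j) * c j)) * h3
    calc (1 - 2 * η) * (√(w j) * (√δ * c j))
        = √(w j / δ) * c j * (δ * (1 - 2 * η)) := by rw [← hs]; ring
      _ ≤ √(w j / δ) * c j * (δ * ∫ x in (0 : ℝ)..1, √(ψ x)) := by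
          refine mul_le_mul_of_nonneg_left (mul_le_mul_of_nonneg_left hI hδ.le)
            (mul_nonneg (Real.sqrt_nonneg _) (hc j hj))
      _ = ∫ x in (s - (j + 2 : ℕ) * δ)..(s - (j + 1 : ℕ) * δ),
            √(w j / δ) * c j * √(ψ ((x - (s - (j + 2 : ℕ) * δ)) / δ)) := by
          rw [intervalIntegral.integral_const_mul, h1]
      _ ≤ _ := by
          refine intervalIntegral.integral_mono_on_of_le_Ioo hle
            (Continuous.intervalIntegrable (by fun_prop) _ _) hFi.intervalIntegrable ?_
          intro x hx
          have h4 : w j / δ * ψ ((x - (s - (j + 2 : ℕ) * δ)) / δ) ≤ deriv A x := by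
            rw [hderiv]
            have := Finset.single_le_sum (f := fun j =>
              w j * (ψ ((x - (s - (j + 2 : ℕ) * δ)) / δ) * (1 / δ)))
              (fun j _ => mul_nonneg (hw j) (mul_nonneg (hψ0 _) (by positivity)))
              (Finset.mem_range.2 hj)
            refine le_trans (le_of_eq ?_) this
            ring
          have h5 := hcg j hj x ⟨hx.1, hx.2.le⟩
          have h6 : 0 ≤ deriv A x := by rw [hderiv]; exact hA'0 x
          simp only [hF]
          rw [Real.sqrt_mul h6, mul_right_comm, ← Real.sqrt_mul (div_nonneg (hw j) hδ.le)]
          exact mul_le_mul (Real.sqrt_le_sqrt h4) h5 (hc j hj) (Real.sqrt_nonneg _)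
  have hadj := intervalIntegral.sum_integral_adjacent_intervals (μ := volume) (f := F)
    (a := fun j : ℕ => s - (j + 1 : ℕ) * δ) (n := K) fun j _ => hFi.intervalIntegrable
  calc (1 - 2 * η) * ∑ j ∈ Finset.range K, √(w j) * (√δ * c j)
      ≤ ∑ j ∈ Finset.range K, ∫ x in (s - (j + 2 : ℕ) * δ)..(s - (j + 1 : ℕ) * δ), F x := by
        rw [Finset.mul_sum]
        exact Finset.sum_le_sum fun j hj => hcell j (Finset.mem_range.1 hj)
    _ = ∫ x in (s - (K + 1 : ℕ) * δ)..(s - (0 + 1 : ℕ) * δ), F x := by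
        rw [intervalIntegral.integral_symm, ← hadj, ← Finset.sum_neg_distrib]
        refine Finset.sum_congr rfl fun j _ => ?_
        rw [← intervalIntegral.integral_symm]
    _ ≤ ∫ x, F x := by
        rw [intervalIntegral.integral_of_le (by
          push_cast
          have : (0 : ℝ) ≤ K := K.cast_nonneg
          nlinarith)]
        exact setIntegral_le_integral hFi (Eventually.of_forall hF0)

end Interpolation

end RNC

namespace RNC

open MeasureTheory ProbabilityTheory
open scoped NNReal

/-! ### The upper bound for majorization conversions. -/

section Converse

variable {Y : Type*} [Fintype Y]

theorem lowMass_le_topSum {R : Y → ℝ} (hR : R ∈ stdSimplex ℝ Y) (θ : ℝ) :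
    lowMass R θ ≤ topSum R ⌊(2 : ℝ) ^ θ⌋₊ := by
  refine le_trans (le_of_eq ?_) (sum_le_topSum hR.1
    ({y | 0 < R y ∧ -Real.logb 2 (R y) ≤ θ} : Finset Y)
    (Nat.le_floor (card_filter_le_rpow hR θ)))
  rw [lowMass, Finset.sum_filter, Finset.sum_filter]
  refine Finset.sum_congr rfl fun y _ => ?_
  rcases (hR.1 y).eq_or_lt with h | h
  · simp [← h]
  · simp [h]

/-- Among any l elements, those of self-information above θ have mass at most 2^(-θ) each. -/
theorem topSum_le_lowMass_add {R : Y → ℝ} (hR : R ∈ stdSimplex ℝ Y) (l : ℕ) (θ : ℝ) :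
    topSum R l ≤ lowMass R θ + l * 2 ^ (-θ) := by
  obtain ⟨S, hS, h⟩ := exists_topSum_eq R l
  rw [h, ← Finset.sum_filter_add_sum_filter_not S (fun y => -Real.logb 2 (R y) ≤ θ)]
  refine add_le_add (Finset.sum_le_sum_of_subset_of_nonneg
    (Finset.filter_subset_filter _ (Finset.subset_univ _)) fun y _ _ => hR.1 y) ?_
  have h1 : ∑ y ∈ S with ¬ -Real.logb 2 (R y) ≤ θ, R y ≤
      (S.filter fun y => ¬ -Real.logb 2 (R y) ≤ θ).card • (2 : ℝ) ^ (-θ) := by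
    refine Finset.sum_le_card_nsmul _ _ _ fun y hy => ?_
    rw [Finset.mem_filter, not_le] at hy
    rcases (hR.1 y).eq_or_lt with h0 | h0
    · rw [← h0]
      positivity
    · rw [← Real.logb_le_iff_le_rpow (by norm_num) h0]
      linarith
  refine h1.trans ?_
  rw [nsmul_eq_mul]
  refine mul_le_mul_of_nonneg_right ?_ (by positivity)
  exact_mod_cast (Finset.card_filter_le _ _).trans hS

variable {𝒳 𝒴 : ℕ → Type*} [∀ n, Fintype (𝒳 n)] [∀ n, Fintype (𝒴 n)]

/-- Counting the 2^{a + ub} largest values amounts to thresholding at u: raising the threshold to u'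
> u leaves an error of at most 2^{-(u' - u) b_n}, and G is continuous. -/
theorem tendsto_topSum {q : ∀ n, 𝒴 n → ℝ} (hq : ∀ n, q n ∈ stdSimplex ℝ (𝒴 n))
    {a b : ℕ → ℝ} (hb : Tendsto b atTop atTop) {G : ℝ → ℝ} (hG : Continuous G)
    (hql : ∀ u, Tendsto (fun n => lowMass (q n) (a n + u * b n)) atTop (𝓝 (G u))) (u : ℝ) :
    Tendsto (fun n => topSum (q n) ⌊(2 : ℝ) ^ (a n + u * b n)⌋₊) atTop (𝓝 (G u)) := by
  rw [tendsto_order]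
  constructor
  · intro c hc
    filter_upwards [(hql u).eventually (lt_mem_nhds hc)] with n hn
    exact hn.trans_le (lowMass_le_topSum (hq n) _)
  · intro c hc
    obtain ⟨u', hu', huu⟩ : ∃ u', G u' < c ∧ u < u' :=
      (((hG.tendsto u).eventually (gt_mem_nhds hc)).filter_mono nhdsWithin_le_nhds
        |>.and (self_mem_nhdsWithin (s := Set.Ioi u))).exists
    have h1 := (hql u').add (tendsto_two_rpow_neg_mul_atTop hb (sub_pos.2 huu))
    rw [add_zero] at h1
    filter_upwards [h1.eventually (gt_mem_nhds hu')] with n hn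
    refine lt_of_le_of_lt ((topSum_le_lowMass_add (hq n) _ (a n + u' * b n)).trans ?_) hn
    refine add_le_add_right ?_ _
    calc (⌊(2 : ℝ) ^ (a n + u * b n)⌋₊ : ℝ) * 2 ^ (-(a n + u' * b n))
        ≤ 2 ^ (a n + u * b n) * 2 ^ (-(a n + u' * b n)) :=
          mul_le_mul_of_nonneg_right (Nat.floor_le (by positivity)) (by positivity)
      _ = 2 ^ (-((u' - u) * b n)) := by
          rw [← Real.rpow_add (by norm_num)]
          congr 1
          ring

/-- The grid masses of P'' depend on n and need not converge. This is harmless: they are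
interpolated by an admissible A for each n separately, and f bounds all admissible functions at
once. -/
theorem eventually_majFidelity_le {p : ∀ n, 𝒳 n → ℝ} {q : ∀ n, 𝒴 n → ℝ}
    (hp : ∀ n, p n ∈ stdSimplex ℝ (𝒳 n)) (hq : ∀ n, q n ∈ stdSimplex ℝ (𝒴 n))
    {a b : ℕ → ℝ} (hb : Tendsto b atTop atTop) {μ : ℝ} {v : ℝ≥0} (hv : v ≠ 0)
    (hpl : ∀ u, Tendsto (fun n => lowMass (p n) (a n + u * b n)) atTop (𝓝 (stdNormalCDF u)))
    (hql : ∀ u, Tendsto (fun n => lowMass (q n) (a n + u * b n)) atTop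
      (𝓝 (cdf (gaussianReal μ v) u)))
    {M : ℕ → ℕ} {s : ℝ}
    (hM : Tendsto (fun n => (Real.logb 2 (M n) - a n) / b n) atTop (𝓝 s))
    {f : ℝ} (hf0 : 0 ≤ f)
    (hf : ∀ A ∈ admissibleCDF s, contFidelity (deriv A) (gaussianPDFReal μ v) ≤ f)
    {c : ℝ} (hc : f < c) : ∀ᶠ n in atTop, majFidelity (p n) (q n) (M n) ≤ c := by
  obtain ⟨L, hL0, hL⟩ := exists_lipschitz_sqrt_gaussianPDFReal (μ := μ) hv
  set G := cdf (gaussianReal μ v) with hGdef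
  -- The five errors are: smoothing by η, mesh, convergence of the target cells, convergence of the
  -- target tail, and the size of the Gaussian tail.
  set ε := (c - f) / 5 with hε
  have hε0 : 0 < ε := by rw [hε]; linarith
  obtain ⟨K, δ, hδ, -, hG2, hmesh⟩ :=
    exists_grid (tendsto_cdf_atBot (gaussianReal μ v)) (3 * L) s hε0
  obtain ⟨η, hη, hη0, hη1⟩ : ∃ η : ℝ, f / (1 - 2 * η) < f + ε ∧ 0 < η ∧ η < 1 / 2 := by
    have hcont : Tendsto (fun η : ℝ => f / (1 - 2 * η)) (𝓝[>] 0) (𝓝 (f / (1 - 2 * 0))) :=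
      (tendsto_const_nhds.div (Continuous.tendsto (by fun_prop) 0) (by norm_num)).mono_left
        nhdsWithin_le_nhds
    rw [mul_zero, sub_zero, div_one] at hcont
    have h1 : ∀ᶠ η : ℝ in 𝓝[>] 0, η < 1 / 2 :=
      (gt_mem_nhds (by norm_num : (0 : ℝ) < 1 / 2)).filter_mono nhdsWithin_le_nhds
    obtain ⟨η, h2, h3, h4⟩ := ((hcont.eventually (gt_mem_nhds (by linarith : f < f + ε))).and
      (h1.and self_mem_nhdsWithin)).exists
    exact ⟨η, h2, h4, h3⟩
  -- The cut points lie one cell above s - jδ. Thus x 0 = s + δ exceeds the storage bound, and Φ(s -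
  -- jδ) < Φ(x j) is strict, so it survives the passage to large n.
  set x : ℕ → ℝ := fun j => s - ((j : ℝ) - 1) * δ with hx
  set l : ℕ → ℕ → ℕ := fun n j => ⌊(2 : ℝ) ^ (a n + x j * b n)⌋₊ with hl
  have hxanti : ∀ i j : ℕ, i ≤ j → x j ≤ x i := by
    intro i j hij
    have : (i : ℝ) ≤ j := by exact_mod_cast hij
    simp only [hx]
    nlinarith
  set κ := ε / (√K + 1) with hκ
  have hκ0 : 0 < κ := by positivity
  have hκK : κ * √K ≤ ε := by
    rw [hκ, div_mul_eq_mul_div, div_le_iff₀ (by positivity)]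
    nlinarith
  have hts : ∀ j, Tendsto (fun n => topSum (q n) (l n j)) atTop (𝓝 (G (x j))) :=
    fun j => tendsto_topSum hq hb (continuous_cdf_gaussianReal hv) hql (x j)
  have e1 : ∀ᶠ n in atTop, ∀ j ∈ Finset.range (K + 1),
      stdNormalCDF (s - j * δ) < lowMass (p n) (a n + x j * b n) := by
    refine (eventually_all_finset _).2 fun j _ => (hpl _).eventually (lt_mem_nhds ?_)
    refine strictMono_stdNormalCDF ?_
    simp only [hx]
    linarith
  have e2 : ∀ᶠ n in atTop, ∀ j ∈ Finset.range K,
      √(topSum (q n) (l n j) - topSum (q n) (l n (j + 1))) <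
        √(G (x j) - G (x (j + 1))) + κ :=
    (eventually_all_finset _).2 fun j _ => (((hts j).sub (hts (j + 1))).sqrt).eventually
      (gt_mem_nhds (by linarith))
  have e3 : ∀ᶠ n in atTop, √(topSum (q n) (l n K)) < √(G (x K)) + ε :=
    ((hts K).sqrt).eventually (gt_mem_nhds (by linarith))
  filter_upwards [e1, e2, e3, hb.eventually_gt_atTop 0,
    hM.eventually (gt_mem_nhds (lt_add_of_pos_right s hδ))] with n h1 h2 h3 hbn hMn
  refine Real.sSup_le ?_ (by linarith)
  rintro _ ⟨P', hP', P'', hP'', hm1, hm2, rfl⟩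
  have hlanti : Antitone (l n) := fun i j hij => Nat.floor_le_floor
    (Real.rpow_le_rpow_of_exponent_le (by norm_num)
      (add_le_add_right (mul_le_mul_of_nonneg_right (hxanti i j hij) hbn.le) _))
  have hMl : M n ≤ l n 0 := by
    rcases Nat.eq_zero_or_pos (M n) with h | h
    · omega
    · refine Nat.le_floor ?_
      rw [← Real.logb_le_iff_le_rpow (by norm_num) (by exact_mod_cast h)]
      rw [div_lt_iff₀ hbn] at hMn
      have : x 0 = s + δ := by simp only [hx]; push_cast; ring
      rw [this]
      linarith
  set α : ℕ → ℝ := fun j => topSum P'' (l n j) with hαdef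
  have hα : Antitone α := (topSum_mono hP''.1).comp_antitone hlanti
  have hα0 : α 0 = 1 := by
    refine le_antisymm ((topSum_le_sum hP''.1 _).trans_eq hP''.2) ?_
    calc (1 : ℝ) = topSum P' (M n) := by rw [topSum_of_card_le (by simp), hP'.2]
      _ ≤ topSum P'' (M n) := hm2 _
      _ ≤ _ := topSum_mono hP''.1 hMl
  have hΦ : ∀ j ≤ K, stdNormalCDF (s - j * δ) ≤ α j := by
    intro j hj
    calc stdNormalCDF (s - j * δ) ≤ lowMass (p n) (a n + x j * b n) :=
          (h1 j (Finset.mem_range.2 (by omega))).le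
      _ ≤ topSum (p n) (l n j) := lowMass_le_topSum (hp n) _
      _ ≤ topSum P' (l n j) := hm1 _
      _ ≤ topSum P'' (l n j) := hm2 _
  have hw : ∀ j, 0 ≤ α j - α (j + 1) := fun j => sub_nonneg.2 (hα (Nat.le_succ j))
  have hw1 : ∑ j ∈ Finset.range K, (α j - α (j + 1)) ≤ 1 := by
    rw [Finset.sum_range_sub', hα0]
    have : 0 ≤ α K := topSum_nonneg hP''.1 _
    linarith
  have hξ : ∀ j : ℕ, ∃ ξ ∈ Set.Ioo (x (j + 1)) (x j),
      √(G (x j) - G (x (j + 1))) = √δ * √(gaussianPDFReal μ v ξ) := fun j =>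
    exists_sqrt_cdf_sub_eq hv hδ (by simp only [hx]; push_cast; ring)
  choose ξ hξmem hξeq using hξ
  -- A lower bound for √(density) on the cell that will carry the mass w j, all of whose points are
  -- within 3δ of ξ j; truncation at 0 keeps it nonnegative.
  set γ : ℕ → ℝ := fun j => max 0 (√(gaussianPDFReal μ v (ξ j)) - 3 * L * δ) with hγ
  obtain ⟨A, hA, hAle⟩ := exists_admissible_interpolation (s := s) (μ := μ) (v := v) (c := γ) hδ hη0
    hη1 hα hα0 hΦ (fun j _ => le_max_left _ _) (by
      intro j _ y hy
      refine max_le (Real.sqrt_nonneg _) ?_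
      have hdist : |ξ j - y| ≤ 3 * δ := by
        obtain ⟨h4, h5⟩ := hξmem j
        obtain ⟨h6, h7⟩ := hy
        simp only [hx] at h4 h5
        push_cast at h4 h5 h6 h7
        rw [abs_le]
        constructor <;> linarith
      have h8 := (abs_le.1 (hL (ξ j) y)).2
      have h9 : L * |ξ j - y| ≤ L * (3 * δ) := mul_le_mul_of_nonneg_left hdist hL0
      linarith)
  have hAf : ∑ j ∈ Finset.range K, √(α j - α (j + 1)) * (√δ * γ j) ≤ f / (1 - 2 * η) := by
    rw [le_div_iff₀ (by linarith), mul_comm]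
    exact hAle.trans (hf A hA)
  have hb1 := fidelity_le_sum_topSum hP'' (hq n) hlanti hα0 K
  have hb2 := sum_sqrt_mul_le_add hw hw1
    (f := fun j => √(topSum (q n) (l n j) - topSum (q n) (l n (j + 1))))
    (g := fun j => √(G (x j) - G (x (j + 1)))) hκ0.le
    fun j hj => (h2 j (Finset.mem_range.2 hj)).le
  have hb3 := sum_sqrt_mul_le_add hw hw1
    (f := fun j => √(G (x j) - G (x (j + 1)))) (g := fun j => √δ * γ j)
    (κ := 3 * L * δ * √δ) (by positivity) (by
      intro j _
      rw [hξeq j]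
      have h4 : √(gaussianPDFReal μ v (ξ j)) - 3 * L * δ ≤ γ j := le_max_right _ _
      have h5 := mul_le_mul_of_nonneg_left h4 (Real.sqrt_nonneg δ)
      linarith)
  have : f + 5 * ε = c := by rw [hε]; ring
  have hfin : √(G (x K)) ≤ ε := hG2
  linarith

end Converse

end RNC

namespace RNC

open MeasureTheory ProbabilityTheory
open scoped NNReal

/-! ### Convergence of both optimal fidelities. -/

section Limits

theorem one_mem_admissibleCDF (s : ℝ) : (fun _ => 1 : ℝ → ℝ) ∈ admissibleCDF s :=
  ⟨contDiff_const, monotone_const, rfl, fun _ => ⟨cdf_le_one _ _, le_rfl⟩⟩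

theorem contFidelity_le_sqrt_one_sub_rayleighNormal {v s μ : ℝ} (hv : 0 < v) {A : ℝ → ℝ}
    (hA : A ∈ admissibleCDF s) :
    contFidelity (deriv A) (gaussianPDFReal μ v.toNNReal) ≤ √(1 - rayleighNormal v s μ) := by
  have hvn : v.toNNReal ≠ 0 := by simpa using hv
  refine Real.le_sqrt_of_sq_le ?_
  rw [rayleighNormal, sub_sub_cancel]
  refine le_csSup ⟨1, ?_⟩ ⟨A, hA, rfl⟩
  rintro _ ⟨B, hB, rfl⟩
  exact pow_le_one₀ (contFidelity_nonneg _ _) (contFidelity_le_one hvn hB)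

theorem exists_lt_contFidelity {v s μ c : ℝ} (hc : c < √(1 - rayleighNormal v s μ)) :
    ∃ A ∈ admissibleCDF s, c < contFidelity (deriv A) (gaussianPDFReal μ v.toNNReal) := by
  rcases lt_or_ge c 0 with h0 | h0
  · exact ⟨_, one_mem_admissibleCDF s, h0.trans_le (contFidelity_nonneg _ _)⟩
  · rw [Real.lt_sqrt h0, rayleighNormal, sub_sub_cancel] at hc
    obtain ⟨_, ⟨A, hA, rfl⟩, h⟩ := exists_lt_of_lt_csSup
      (Set.Nonempty.image _ ⟨_, one_mem_admissibleCDF s⟩) hc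
    exact ⟨A, hA, lt_of_pow_lt_pow_left₀ 2 (contFidelity_nonneg _ _) h⟩

variable {𝒳 𝒴 : ℕ → Type*} [∀ n, Fintype (𝒳 n)] [∀ n, Fintype (𝒴 n)]

/-- Both optimal fidelities converge, whenever the distributions of the normalized
self-informations of source and target converge to normal distributions. -/
theorem tendsto_detFidelity_and_majFidelity {p : ∀ n, 𝒳 n → ℝ} {q : ∀ n, 𝒴 n → ℝ}
    (hp : ∀ n, p n ∈ stdSimplex ℝ (𝒳 n)) (hq : ∀ n, q n ∈ stdSimplex ℝ (𝒴 n))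
    {a b : ℕ → ℝ} (hb : Tendsto b atTop atTop)
    (hab : ∀ u, Tendsto (fun n => a n + u * b n) atTop atTop) {μ v : ℝ} (hv : 0 < v)
    (hpl : ∀ u, Tendsto (fun n => lowMass (p n) (a n + u * b n)) atTop (𝓝 (stdNormalCDF u)))
    (hql : ∀ u, Tendsto (fun n => lowMass (q n) (a n + u * b n)) atTop
      (𝓝 (cdf (gaussianReal μ v.toNNReal) u)))
    {M : ℕ → ℕ} {s : ℝ}
    (hM : Tendsto (fun n => (Real.logb 2 (M n) - a n) / b n) atTop (𝓝 s)) :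
    Tendsto (fun n => detFidelity (p n) (q n) (M n)) atTop (𝓝 √(1 - rayleighNormal v s μ)) ∧
      Tendsto (fun n => majFidelity (p n) (q n) (M n)) atTop
        (𝓝 √(1 - rayleighNormal v s μ)) := by
  have hvn : v.toNNReal ≠ 0 := by simpa using hv
  have hle : ∀ n, detFidelity (p n) (q n) (M n) ≤ majFidelity (p n) (q n) (M n) :=
    fun n => detFidelity_le_majFidelity (hp n) (hq n) (M n)
  have hlow : ∀ c < √(1 - rayleighNormal v s μ),
      ∀ᶠ n in atTop, c < detFidelity (p n) (q n) (M n) := by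
    intro c hc
    obtain ⟨A, hA, hcA⟩ := exists_lt_contFidelity hc
    exact eventually_lt_detFidelity hp hq hb hab hvn hpl hql hM hA hcA
  have hup : ∀ c > √(1 - rayleighNormal v s μ),
      ∀ᶠ n in atTop, majFidelity (p n) (q n) (M n) < c := by
    intro c hc
    obtain ⟨c', h1, h2⟩ := exists_between hc
    filter_upwards [eventually_majFidelity_le hp hq hb hvn hpl hql hM (Real.sqrt_nonneg _)
      (fun A hA => contFidelity_le_sqrt_one_sub_rayleighNormal hv hA) h1] with n hn
    exact hn.trans_lt h2
  refine ⟨tendsto_order.2 ⟨hlow, fun c hc => ?_⟩, tendsto_order.2 ⟨fun c hc => ?_, hup⟩⟩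
  · filter_upwards [hup c hc] with n hn
    exact (hle n).trans_lt hn
  · filter_upwards [hlow c hc] with n hn
    exact hn.trans_le (hle n)

end Limits

end RNC

/-! ### The main theorem. -/

theorem theorem3 {X Y : Type*} [Fintype X] [Fintype Y]
    (P : X → ℝ) (Q : Y → ℝ)
    (hP : P ∈ stdSimplex ℝ X) (hQ : Q ∈ stdSimplex ℝ Y)
    (hPu : ¬ IsUniform P) (hQu : ¬ IsUniform Q)
    (s₂ t₂ : ℝ) (M T : ℕ → ℕ)
    (hM : (fun n : ℕ => Real.logb 2 (M n) - (entropy P * n + s₂ * √(n : ℝ)))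
      =o[atTop] fun n : ℕ => √(n : ℝ))
    (hT : (fun n : ℕ => (T n : ℝ) - (entropy P / entropy Q * n + t₂ * √(n : ℝ)))
      =o[atTop] fun n : ℕ => √(n : ℝ)) :
    liminf (fun n : ℕ => detFidelity (iid P n) (iid Q (T n)) (M n)) atTop =
        √(1 - rayleighNormal (coeffC P Q) (s₂ / √(varentropy P)) (t₂ * coeffD P Q)) ∧
      liminf (fun n : ℕ => majFidelity (iid P n) (iid Q (T n)) (M n)) atTop =
        √(1 - rayleighNormal (coeffC P Q) (s₂ / √(varentropy P)) (t₂ * coeffD P Q)) := by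
  have hVP := varentropy_pos hP hPu
  have hVQ := varentropy_pos hQ hQu
  have hHP := entropy_pos hP hPu
  have hHQ := entropy_pos hQ hQu
  have hC : 0 < coeffC P Q := by
    unfold coeffC
    positivity
  have hσ : 0 < √(varentropy P) := Real.sqrt_pos.2 hVP
  have hsq : Tendsto (fun n : ℕ => √(n : ℝ)) atTop atTop :=
    Real.tendsto_sqrt_atTop.comp tendsto_natCast_atTop_atTop
  have hb_eq : ∀ n : ℕ, √(varentropy P * n) = √(varentropy P) * √(n : ℝ) :=
    fun n => Real.sqrt_mul hVP.le _
  have hb : Tendsto (fun n : ℕ => √(varentropy P * n)) atTop atTop := by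
    simp only [hb_eq]
    exact hsq.const_mul_atTop hσ
  have hab : ∀ u, Tendsto (fun n : ℕ => entropy P * n + u * √(varentropy P * n)) atTop atTop := by
    intro u
    have h1 : Tendsto (fun n : ℕ => entropy P * √(n : ℝ) + u * √(varentropy P)) atTop atTop :=
      tendsto_atTop_add_const_right _ _ (hsq.const_mul_atTop hHP)
    refine (hsq.atTop_mul_atTop₀ h1).congr fun n => ?_
    have h2 : √(n : ℝ) * √(n : ℝ) = n := Real.mul_self_sqrt n.cast_nonneg
    rw [hb_eq]
    linear_combination entropy P * h2
  have hMlim : Tendsto (fun n : ℕ => (Real.logb 2 (M n) - entropy P * n) / √(varentropy P * n))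
      atTop (𝓝 (s₂ / √(varentropy P))) := by
    have h1 := ((hM.tendsto_div_nhds_zero).const_add s₂).div_const √(varentropy P)
    rw [add_zero] at h1
    refine h1.congr' ?_
    filter_upwards [eventually_gt_atTop 0] with n hn
    have hs : 0 < √(n : ℝ) := Real.sqrt_pos.2 (by exact_mod_cast hn)
    rw [hb_eq]
    field_simp
    ring
  -- The scale is a n = H(P)n and b n = √(V(P)n), under which the normalized storage bound tends to
  -- s₂/√V(P).
  have h := tendsto_detFidelity_and_majFidelity (fun n => iid_mem_stdSimplex hP n)
    (fun n => iid_mem_stdSimplex hQ (T n)) hb hab hC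
    (fun u => tendsto_lowMass_iid_source hP hVP u)
    (fun u => tendsto_lowMass_iid_target hQ hHP hHQ hVP hVQ hT u) hMlim
  exact ⟨h.1.liminf_eq, h.2.liminf_eq⟩
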